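/- **Setting.** Fix $a,q,\sigma_\pm,\beta\in(0,\infty)$ and $\mu_\pm>0$. Put $\theta^{\pm}_1=\frac{\sqrt{\mu_\pm^2+2q\sigma_\pm^2}+\mu_\pm}{\sigma_\pm^2}$, $\theta^{\pm}_2=\frac{\sqrt{\mu_\pm^2+2q\sigma_\pm^2}-\mu_\pm}{\sigma_\pm^2}$, $c_-=\frac{\theta_1^--\theta_1^+}{\theta_2^-+\theta_1^-}$, $c_+=\frac{\theta_2^+-\theta_2^-}{\theta_2^++\theta_1^+}$, $$g^-(x)=\begin{cases}e^{-\theta_1^+(x-a)},&x>a\\ c_-e^{\theta_2^-(x-a)}+(1-c_-)e^{-\theta_1^-(x-a)},&x\le a\end{cases}\qquad g^+(x)=\begin{cases}(1-c_+)e^{\theta_2^+(x-a)}+c_+e^{-\theta_1^+(x-a)},&x>a\\ e^{\theta_2^-(x-a)},&x\le a\end{cases}$$ and $g(x)=g^+(x)g^-(0)-g^-(x)g^+(0)$. Let $\mathcal D_\zeta=\{(x,y)\in[0,\infty)^2:x+\beta\le y\}$, $\zeta(z_1,z_2)=\frac{z_2-z_1-\beta}{g(z_2)-g(z_1)}$ on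 $\mathcal D_\zeta$, let $\mathcal M_\zeta$ be the set of global maximizers of $\zeta$ on $\mathcal D_\zeta$, and put $\psi(x,y)=\int_x^y\big(1-\frac{g'(s)}{g'(y)}\big)\,ds$. Put, whenever the logarithms are defined, $$x_0=\frac{\ln\frac{(g^+(0)-c_+g^-(0))(\theta_1^+)^2}{(1-c_+)g^-(0)(\theta_2^+)^2}}{\theta_2^++\theta_1^+}+a,\quad \Theta=c_+(\theta_1^+)^2+(1-c_+)(\theta_2^+)^2,\quad a_1=\frac{2\ln(\theta_1^- /\theta_2^-)}{\theta_2^-+\theta_1^-},$$ $$a_2=\frac{\ln\frac{\theta_2^++\theta_1^-}{\theta_2^+-\theta_2^-}}{\theta_1^-+\theta_2^-},\quad a_3=\frac{\ln\frac{(1-c_-c_+)(\theta_1^+)^2-(1-c_+)c_-(\theta_2^+)^2}{(1-c_-)\Theta}}{\theta_1^-+\theta_2^-}.$$ **Cases.** (i): $0<a_2\le a\le a_1$, $c_+>0$; or $0<a_3\le a\le a_1\wedge a_2$, $c_+>0$; or $0<a_3\le a\le a_1$, $c_+\le0$, $\Theta>0$. (ii): $a\le a_1\wedge a_2\wedge a_3$,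 $c_+>0$; or $a\le a_1$, $c_+\le0$, $\Theta\le0$; or $a\le a_1\wedge a_3$, $c_+\le0$, $\Theta>0$. (iii): $a_1\vee a_2\le a$, $c_+>0$; or $a_1\vee a_3\le a<a_2$, $c_+>0$; or $a_1\vee a_3\le a$, $c_+\le0$, $\Theta>0$. (iv): $a_1<a<a_2\wedge a_3$, $c_+>0$; or $a_1<a$, $c_+\le0$, $\Theta\le0$; or $a_1<a<a_3$, $c_+\le0$, $\Theta>0$. **Notation.** For $m>0$ let $\ell_m(y)=\inf\{z\in[0,m]:g'(z)\le y\}$ for $y\ge g'(m)$, and $\phi_m(x)=\psi(\ell_m(g'(x)),x)$ for $x\in[m,\infty)$; write $\phi=\phi_a$, $\bar\phi=\phi_{x_0}$, $\tilde\phi=\phi_{a_1}$. In Case (iv), let $(g')_1^{-1}=\ell_{a_1}$, let $(g')^{-1}_2,(g')^{-1}_3,(g')^{-1}_4$ be the inverses of $g'$ restricted to $[a_1,a]$, $[a,x_0]$, $[x_0,\infty)$, let $a_5=\inf\{x\ge x_0:g'(x)\ge g'(a_1)\}$, $a_6=(g')_4^{-1}(g'(a))$, and $$x_1=\inf\Big\{x\in[a_5,a_6]:\int_{(g')_1^{-1}(g'(x))}^{(g')_3^{-1}(g'(x))}\Big(1-\tfrac{g'(s)}{g'(x)}\Big)ds\ge0\Big\},\qquad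 x_2=\inf\big\{x\in[a_5,a_6]:\psi((g')_2^{-1}(g'(x)),x)\ge0\big\},$$ $\omega_1(x)=\psi((g')_1^{-1}(g'(x)),x)$ for $x\in[a_1,(g')_2^{-1}(g'(x_2))]\cup[x_2,\infty)$; $\omega_2(x)=\psi((g')_3^{-1}(g'(x)),x)$ for $x\in[x_0,x_1)$ and $\omega_2(x)=\psi((g')_1^{-1}(g'(x)),x)$ for $x\in[x_1,\infty)$. Let $\omega_i^{-1}(b)$ denote the preimage of $b$ in the domain of $\omega_i$, and $$\tilde Z=\{((g')_1^{-1}(g'(y)),y):y\in\omega_1^{-1}(\beta)\},\qquad \bar Z=\{((g')_3^{-1}(g'(y)),y):y\in\omega_2^{-1}(\beta)\}.$$ Let $A_1=\{b>0:g'(\omega_1^{-1}(b))<g'(\omega_2^{-1}(b))\}$, $A_2=\{b>0:g'(\omega_1^{-1}(b))>g'(\omega_2^{-1}(b))\}$, where $g'(\omega_i^{-1}(b))$ is the value of $g'$ at a point of $\omega_i^{-1}(b)$, read as $+\infty$ if $\omega_i^{-1}(b)=\emptyset$ (precisely: $b\in A_1$ iff some $y\in\omega_1^{-1}(b)$ satisfies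 $g'(y)<g'(w)$ for all $w\in\omega_2^{-1}(b)$, and symmetrically for $A_2$). Let $A_3=(\omega_2(x_1),\infty)$ and $\overline A=(0,\infty)\setminus A$. **Theorem.** Suppose $\mu_\pm>0$. * Under Case (i), $\phi:[a,\infty)\to[0,\infty)$ is a bijection and $\mathcal M_\zeta=\{(\ell_a(g'(\phi^{-1}(\beta))),\phi^{-1}(\beta))\}$. * Under Case (ii), $\bar\phi:[x_0,\infty)\to[0,\infty)$ is a bijection and $\mathcal M_\zeta=\{(\ell_{x_0}(g'(\bar\phi^{-1}(\beta))),\bar\phi^{-1}(\beta))\}$. * Under Case (iii), $\tilde\phi:[a_1,\infty)\to[0,\infty)$ is a bijection and $\mathcal M_\zeta=\{(\ell_{a_1}(g'(\tilde\phi^{-1}(\beta))),\tilde\phi^{-1}(\beta))\}$. * Under Case (iv), $a<x_0$, and $g'$ maps $[a_1,a]$, $[a,x_0]$, $[x_0,\infty)$ bijectively onto $[g'(a_1),g'(a)]$, $[g'(x_0),g'(a)]$, $[g'(x_0),\infty)$. The sets $\omega_1^{-1}(\beta)$, $\omega_2^{-1}(\beta)$ are not both empty; $\omega_2^{-1}(\beta)$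 has at most one element, and so has $\omega_1^{-1}(\beta)$ if $\beta\ne\omega_1(x_2)$. If $\beta=\omega_1(x_2)$, then $\omega_1^{-1}(\beta)=\{(g')_2^{-1}(g'(x_2)),x_2\}$ when $x_2>a_5$, and $\omega_1^{-1}(\beta)=\{x_2\}$ when $x_2=a_5$. Moreover $A_2\cap A_3=\emptyset$ and $$\mathcal M_\zeta=\begin{cases}\tilde Z,&\beta\in A_1\cup A_3,\\ \bar Z,&\beta\in A_2\cap\overline{A}_3,\\ \tilde Z\cup\bar Z,&\beta\in\overline{A_1\cup A_2\cup A_3},\end{cases}$$ where $\omega_1^{-1}(\beta)\neq\emptyset$ in the first case, $\omega_2^{-1}(\beta)\ne\emptyset$ in the second, and both are nonempty in the third. -/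

import Mathlib

open Set

noncomputable section

/-- Parameters of the refracted diffusion: threshold `a`, drifts `μp = μ₊`, `μm = μ₋`,
volatilities `σp = σ₊`, `σm = σ₋`, and discount rate `q`. -/
structure Model where
  a : ℝ
  μp : ℝ
  μm : ℝ
  σp : ℝ
  σm : ℝ
  q : ℝ
  a_pos : 0 < a
  σp_pos : 0 < σp
  σm_pos : 0 < σm
  q_pos : 0 < q

namespace Model

variable (P : Model)

/-- `θ₁⁺`. -/
def θ1p : ℝ := (Real.sqrt (P.μp ^ 2 + 2 * P.q * P.σp ^ 2) + P.μp) / P.σp ^ 2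
/-- `θ₂⁺`. -/
def θ2p : ℝ := (Real.sqrt (P.μp ^ 2 + 2 * P.q * P.σp ^ 2) - P.μp) / P.σp ^ 2
/-- `θ₁⁻`. -/
def θ1m : ℝ := (Real.sqrt (P.μm ^ 2 + 2 * P.q * P.σm ^ 2) + P.μm) / P.σm ^ 2
/-- `θ₂⁻`. -/
def θ2m : ℝ := (Real.sqrt (P.μm ^ 2 + 2 * P.q * P.σm ^ 2) - P.μm) / P.σm ^ 2

/-- `c₋`. -/
def cm : ℝ := (P.θ1m - P.θ1p) / (P.θ2m + P.θ1m)
/-- `c₊`. -/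
def cp : ℝ := (P.θ2p - P.θ2m) / (P.θ2p + P.θ1p)

/-- `g⁻`. -/
def gm (x : ℝ) : ℝ :=
  if P.a < x then Real.exp (-P.θ1p * (x - P.a))
  else P.cm * Real.exp (P.θ2m * (x - P.a)) + (1 - P.cm) * Real.exp (-P.θ1m * (x - P.a))

/-- `g⁺`. -/
def gp (x : ℝ) : ℝ :=
  if P.a < x then
    (1 - P.cp) * Real.exp (P.θ2p * (x - P.a)) + P.cp * Real.exp (-P.θ1p * (x - P.a))
  else Real.exp (P.θ2m * (x - P.a))

/-- `g(x) = g⁺(x) g⁻(0) - g⁻(x) g⁺(0)`. -/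
def g (x : ℝ) : ℝ := P.gp x * P.gm 0 - P.gm x * P.gp 0

/-- `g'`. -/
def g' (x : ℝ) : ℝ := deriv P.g x

/-- The domain `𝒟_ζ = {(x, y) ∈ [0,∞)² : x + β ≤ y}`. -/
def D (β : ℝ) : Set (ℝ × ℝ) := {z | 0 ≤ z.1 ∧ 0 ≤ z.2 ∧ z.1 + β ≤ z.2}

/-- `ζ(z₁, z₂) = (z₂ - z₁ - β) / (g(z₂) - g(z₁))`. -/
def ζ (β : ℝ) (z : ℝ × ℝ) : ℝ := (z.2 - z.1 - β) / (P.g z.2 - P.g z.1)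

/-- The set `ℳ_ζ` of global maximizers of `ζ` on `𝒟_ζ`. -/
def M (β : ℝ) : Set (ℝ × ℝ) := {z | z ∈ D β ∧ ∀ w ∈ D β, P.ζ β w ≤ P.ζ β z}

/-- `ψ(x, y) = ∫ₓ^y (1 - g'(s) / g'(y)) ds`. -/
def ψ (x y : ℝ) : ℝ := ∫ s in x..y, (1 - P.g' s / P.g' y)

/-! ### The constants `x₀, Θ, a₁, a₂, a₃` and the four cases -/

def x0 : ℝ :=
  Real.log (((P.gp 0 - P.cp * P.gm 0) * P.θ1p ^ 2) / ((1 - P.cp) * P.gm 0 * P.θ2p ^ 2))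
    / (P.θ2p + P.θ1p) + P.a

def Θ : ℝ := P.cp * P.θ1p ^ 2 + (1 - P.cp) * P.θ2p ^ 2

def a1 : ℝ := 2 * Real.log (P.θ1m / P.θ2m) / (P.θ2m + P.θ1m)

def a2 : ℝ := Real.log ((P.θ2p + P.θ1m) / (P.θ2p - P.θ2m)) / (P.θ1m + P.θ2m)

def a3 : ℝ :=
  Real.log (((1 - P.cm * P.cp) * P.θ1p ^ 2 - (1 - P.cp) * P.cm * P.θ2p ^ 2)
    / ((1 - P.cm) * P.Θ)) / (P.θ1m + P.θ2m)

def CaseI : Prop :=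
  (0 < P.a2 ∧ P.a2 ≤ P.a ∧ P.a ≤ P.a1 ∧ 0 < P.cp) ∨
  (0 < P.a3 ∧ P.a3 ≤ P.a ∧ P.a ≤ min P.a1 P.a2 ∧ 0 < P.cp) ∨
  (0 < P.a3 ∧ P.a3 ≤ P.a ∧ P.a ≤ P.a1 ∧ P.cp ≤ 0 ∧ 0 < P.Θ)

def CaseII : Prop :=
  (P.a ≤ min (min P.a1 P.a2) P.a3 ∧ 0 < P.cp) ∨
  (P.a ≤ P.a1 ∧ P.cp ≤ 0 ∧ P.Θ ≤ 0) ∨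
  (P.a ≤ min P.a1 P.a3 ∧ P.cp ≤ 0 ∧ 0 < P.Θ)

def CaseIII : Prop :=
  (max P.a1 P.a2 ≤ P.a ∧ 0 < P.cp) ∨
  (max P.a1 P.a3 ≤ P.a ∧ P.a < P.a2 ∧ 0 < P.cp) ∨
  (max P.a1 P.a3 ≤ P.a ∧ P.cp ≤ 0 ∧ 0 < P.Θ)

def CaseIV : Prop :=
  (P.a1 < P.a ∧ P.a < min P.a2 P.a3 ∧ 0 < P.cp) ∨
  (P.a1 < P.a ∧ P.cp ≤ 0 ∧ P.Θ ≤ 0) ∨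
  (P.a1 < P.a ∧ P.a < P.a3 ∧ P.cp ≤ 0 ∧ 0 < P.Θ)

/-! ### Inverse branches and the function `φ`, with turning point `m`
(`m = a`, `x₀`, `a₁` in the first three cases) -/

/-- The generalized inverse of `g'` on `[0, m]`: `y ↦ inf {z ∈ [0, m] : g'(z) ≤ y}`. -/
def invL (m y : ℝ) : ℝ := sInf {z | z ∈ Icc 0 m ∧ P.g' z ≤ y}

/-- `φ` with turning point `m`: `x ↦ ψ(invL m (g' x), x)`, for `x ∈ [m, ∞)`. -/
def φ (m x : ℝ) : ℝ := P.ψ (P.invL m (P.g' x)) x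

/-- The inverse of `φ m : [m, ∞) → [0, ∞)`. -/
def φinv (m b : ℝ) : ℝ := Function.invFunOn (P.φ m) (Ici m) b

/-! ### Objects of the fourth case -/

/-- `(g')₁⁻¹`. -/
def inv1 (y : ℝ) : ℝ := P.invL P.a1 y
/-- `(g')₂⁻¹`, the inverse of `g'` on `[a₁, a]`. -/
def inv2 (y : ℝ) : ℝ := Function.invFunOn P.g' (Icc P.a1 P.a) y
/-- `(g')₃⁻¹`, the inverse of `g'` on `[a, x₀]`. -/
def inv3 (y : ℝ) : ℝ := Function.invFunOn P.g' (Icc P.a P.x0) y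
/-- `(g')₄⁻¹`, the inverse of `g'` on `[x₀, ∞)`. -/
def inv4 (y : ℝ) : ℝ := Function.invFunOn P.g' (Ici P.x0) y

def a5 : ℝ := sInf {x | P.x0 ≤ x ∧ P.g' P.a1 ≤ P.g' x}

def a6 : ℝ := P.inv4 (P.g' P.a)

def x1 : ℝ :=
  sInf {x | x ∈ Icc P.a5 P.a6 ∧
    0 ≤ ∫ s in (P.inv1 (P.g' x))..(P.inv3 (P.g' x)), (1 - P.g' s / P.g' x)}

def x2 : ℝ :=
  sInf {x | x ∈ Icc P.a5 P.a6 ∧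
    0 ≤ ∫ s in (P.inv2 (P.g' x))..x, (1 - P.g' s / P.g' x)}

/-- The domain `[a₁, (g')₂⁻¹(g'(x₂))] ∪ [x₂, ∞)` of `ω₁`. -/
def domω1 : Set ℝ := Icc P.a1 (P.inv2 (P.g' P.x2)) ∪ Ici P.x2

def ω1 (x : ℝ) : ℝ := ∫ s in (P.inv1 (P.g' x))..x, (1 - P.g' s / P.g' x)

/-- `ω₂`, on the domain `[x₀, ∞)`. -/
def ω2 (x : ℝ) : ℝ :=
  if x < P.x1 then ∫ s in (P.inv3 (P.g' x))..x, (1 - P.g' s / P.g' x)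
  else ∫ s in (P.inv1 (P.g' x))..x, (1 - P.g' s / P.g' x)

/-- `ω₁⁻¹(b)` as a set: it has two elements at the exceptional value `b = ω₁(x₂)`. -/
def ω1inv (b : ℝ) : Set ℝ := {y | y ∈ P.domω1 ∧ P.ω1 y = b}

/-- `ω₂⁻¹(b)` as a set. -/
def ω2inv (b : ℝ) : Set ℝ := {y | P.x0 ≤ y ∧ P.ω2 y = b}

/-- The set `{(z̃₁, z̃₂)}`. -/
def zTilde (b : ℝ) : Set (ℝ × ℝ) := (fun y => (P.inv1 (P.g' y), y)) '' P.ω1inv b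

/-- The set `{(z̄₁, z̄₂)}`. -/
def zBar (b : ℝ) : Set (ℝ × ℝ) := (fun y => (P.inv3 (P.g' y), y)) '' P.ω2inv b

/-- `A₁ = {b > 0 : g'(ω₁⁻¹(b)) < g'(ω₂⁻¹(b))}`; a value `g'(ωᵢ⁻¹(b))` with `b` outside the range
of `ωᵢ` counts as `+∞`. -/
def A1 : Set ℝ := {b | 0 < b ∧ ∃ y ∈ P.ω1inv b, ∀ w ∈ P.ω2inv b, P.g' y < P.g' w}

/-- `A₂ = {b > 0 : g'(ω₁⁻¹(b)) > g'(ω₂⁻¹(b))}`, with the same convention. -/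
def A2 : Set ℝ := {b | 0 < b ∧ ∃ w ∈ P.ω2inv b, ∀ y ∈ P.ω1inv b, P.g' w < P.g' y}

/-- `A₃ = (ω₂(x₁), ∞)`. -/
def A3 : Set ℝ := Ioi (P.ω2 P.x1)

end Model

end

/-!
If the maximum of `ζ` is `1 / c`, then the maximizers are the intervals `[x, y]` whose net gain
`∫ (1 - g' / c)` at level `c` equals `β`, and no interval has a larger one. Hence `g' = c` at the
right end, which lies on an increasing branch of `g'`, and `g' = c` at the left end, which lies on
a decreasing branch, unless that end is `0`. If `g'` decreases up to `m` and increases from there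
on, both ends are functions of the level, and the net gain between them is a strictly increasing
function `φ` of the right end; so there is exactly one maximizer. If `g'` has two valleys, then
`ω₁` measures intervals starting in the first one and `ω₂` intervals starting in the second one.
Both increase with the level, and a net gain `β` at a level `d` forces `c ≤ d`, so whichever of the
two reaches `β` at the lower level gives the maximizer, and a tie gives both.
-/

section ExpPair

theorem hasDerivAt_exp_pair (A B s t x : ℝ) :
    HasDerivAt (fun x => A * Real.exp (s * x) + B * Real.exp (-t * x))
      (A * s * Real.exp (s * x) - B * t * Real.exp (-t * x)) x := by
  have growing : HasDerivAt (fun x => A * Real.exp (s * x)) (A * (Real.exp (s * x) * (s * 1))) x :=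
    (((hasDerivAt_id x).const_mul s).exp).const_mul A
  have decaying :
      HasDerivAt (fun x => B * Real.exp (-t * x)) (B * (Real.exp (-t * x) * (-t * 1))) x :=
    (((hasDerivAt_id x).const_mul (-t)).exp).const_mul B
  exact (growing.add decaying).congr_deriv (by ring)

variable {A B s t x₀ : ℝ}

theorem strictMonoOn_exp_pair (hA : 0 < A) (hs : 0 < s) (ht : 0 < t)
    (h0 : B * t * Real.exp (-t * x₀) ≤ A * s * Real.exp (s * x₀)) :
    StrictMonoOn (fun x => A * Real.exp (s * x) + B * Real.exp (-t * x)) (Ici x₀) := by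
  refine strictMonoOn_of_deriv_pos (convex_Ici x₀) (by fun_prop) fun x hx => ?_
  rw [interior_Ici, mem_Ioi] at hx
  rw [(hasDerivAt_exp_pair A B s t x).deriv, sub_pos]
  have growing : A * s * Real.exp (s * x₀) < A * s * Real.exp (s * x) := by gcongr
  rcases le_or_gt B 0 with hB | hB
  · calc B * t * Real.exp (-t * x)
        ≤ 0 := mul_nonpos_of_nonpos_of_nonneg (mul_nonpos_of_nonpos_of_nonneg hB ht.le)
          (Real.exp_pos _).le
      _ < A * s * Real.exp (s * x) := by positivity
  · calc B * t * Real.exp (-t * x)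
        ≤ B * t * Real.exp (-t * x₀) := by
          gcongr B * t * Real.exp ?_
          exact mul_le_mul_of_nonpos_left hx.le (neg_nonpos.2 ht.le)
      _ < A * s * Real.exp (s * x) := h0.trans_lt growing

theorem strictAntiOn_exp_pair (hA : 0 < A) (hB : 0 < B) (hs : 0 < s) (ht : 0 < t)
    (h0 : A * s * Real.exp (s * x₀) ≤ B * t * Real.exp (-t * x₀)) :
    StrictAntiOn (fun x => A * Real.exp (s * x) + B * Real.exp (-t * x)) (Iic x₀) := by
  refine strictAntiOn_of_deriv_neg (convex_Iic x₀) (by fun_prop) fun x hx => ?_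
  rw [interior_Iic, mem_Iio] at hx
  rw [(hasDerivAt_exp_pair A B s t x).deriv, sub_neg]
  calc A * s * Real.exp (s * x)
      < A * s * Real.exp (s * x₀) := by gcongr
    _ ≤ B * t * Real.exp (-t * x₀) := h0
    _ ≤ B * t * Real.exp (-t * x) := by
      gcongr B * t * Real.exp ?_
      exact mul_le_mul_of_nonpos_left hx.le (neg_nonpos.2 ht.le)

end ExpPair

/-! ### Net gains -/

/-- The net gain of the interval `[x, y]` at level `c`, that is, `∫ s in x..y, (1 - f' s / c)`
where `f'` is the derivative of `f`. The integral is evaluated, so that no differentiability is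
needed to speak of net gains. -/
noncomputable def netGain (f : ℝ → ℝ) (c x y : ℝ) : ℝ := (y - x) - (f y - f x) / c

section NetGain

variable {f f' : ℝ → ℝ} {c d u u' v v' x y : ℝ}

theorem netGain_self (f : ℝ → ℝ) (c x : ℝ) : netGain f c x x = 0 := by simp [netGain]

theorem netGain_add (f : ℝ → ℝ) (c x y z : ℝ) :
    netGain f c x y + netGain f c y z = netGain f c x z := by
  simp only [netGain]; ring

theorem netGain_le_length (hf : Monotone f) (hc : 0 < c) (hxy : x ≤ y) :
    netGain f c x y ≤ y - x :=
  sub_le_self _ (div_nonneg (sub_nonneg.2 (hf hxy)) hc.le)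

theorem netGain_le_of_level_le (hf : Monotone f) (hc : 0 < c) (hcd : c ≤ d) (hxy : x ≤ y) :
    netGain f c x y ≤ netGain f d x y :=
  sub_le_sub_left (div_le_div_of_nonneg_left (sub_nonneg.2 (hf hxy)) hc hcd) _

theorem netGain_lt_of_level_lt (hf : StrictMono f) (hc : 0 < c) (hcd : c < d) (hxy : x < y) :
    netGain f c x y < netGain f d x y :=
  sub_lt_sub_left (div_lt_div_of_pos_left (sub_pos.2 (hf hxy)) hc hcd) _

theorem integral_one_sub_div_eq_netGain (hf : ∀ s, HasDerivAt f (f' s) s) (hf' : Continuous f')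
    (c x y : ℝ) : ∫ s in x..y, (1 - f' s / c) = netGain f c x y := by
  have antideriv : ∀ s ∈ uIcc x y, HasDerivAt (fun s => s - f s / c) (1 - f' s / c) s :=
    fun s _ => (hasDerivAt_id s).sub ((hf s).div_const c)
  have hint : Continuous fun s => 1 - f' s / c := by fun_prop
  rw [intervalIntegral.integral_eq_sub_of_hasDerivAt antideriv (hint.intervalIntegrable _ _),
    netGain]
  ring

theorem exists_sub_eq_deriv_mul (hf : ∀ s, HasDerivAt f (f' s) s) (hxy : x < y) :
    ∃ s ∈ Ioo x y, f y - f x = f' s * (y - x) := by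
  obtain ⟨s, hs, e⟩ := exists_hasDerivAt_eq_slope f f' hxy
    (fun s _ => (hf s).continuousAt.continuousWithinAt) fun s _ => hf s
  exact ⟨s, hs, by rw [e, div_mul_cancel₀ _ (sub_pos.2 hxy).ne']⟩

theorem exists_netGain_eq_mul (hf : ∀ s, HasDerivAt f (f' s) s) (c : ℝ) (hxy : x < y) :
    ∃ s ∈ Ioo x y, netGain f c x y = (y - x) * (1 - f' s / c) := by
  obtain ⟨s, hs, e⟩ := exists_sub_eq_deriv_mul hf hxy
  exact ⟨s, hs, by rw [netGain, e]; ring⟩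

theorem netGain_pos (hf : ∀ s, HasDerivAt f (f' s) s) (hc : 0 < c) (hxy : x < y)
    (hs : ∀ s ∈ Ioo x y, f' s < c) : 0 < netGain f c x y := by
  obtain ⟨s, hmem, e⟩ := exists_netGain_eq_mul hf c hxy
  exact e ▸ mul_pos (sub_pos.2 hxy) (sub_pos.2 ((div_lt_one hc).2 (hs s hmem)))

theorem netGain_neg (hf : ∀ s, HasDerivAt f (f' s) s) (hc : 0 < c) (hxy : x < y)
    (hs : ∀ s ∈ Ioo x y, c < f' s) : netGain f c x y < 0 := by
  obtain ⟨s, hmem, e⟩ := exists_netGain_eq_mul hf c hxy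
  exact e ▸ mul_neg_of_pos_of_neg (sub_pos.2 hxy) (sub_neg.2 ((one_lt_div hc).2 (hs s hmem)))

theorem netGain_nonneg (hf : ∀ s, HasDerivAt f (f' s) s) (hc : 0 < c) (hxy : x ≤ y)
    (hs : ∀ s ∈ Ioo x y, f' s ≤ c) : 0 ≤ netGain f c x y := by
  rcases hxy.eq_or_lt with rfl | hxy
  · exact (netGain_self f c x).ge
  · obtain ⟨s, hmem, e⟩ := exists_netGain_eq_mul hf c hxy
    exact e ▸ mul_nonneg (sub_nonneg.2 hxy.le) (sub_nonneg.2 ((div_le_one hc).2 (hs s hmem)))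

theorem netGain_nonpos (hf : ∀ s, HasDerivAt f (f' s) s) (hc : 0 < c) (hxy : x ≤ y)
    (hs : ∀ s ∈ Ioo x y, c ≤ f' s) : netGain f c x y ≤ 0 := by
  rcases hxy.eq_or_lt with rfl | hxy
  · exact (netGain_self f c x).le
  · obtain ⟨s, hmem, e⟩ := exists_netGain_eq_mul hf c hxy
    exact e ▸ mul_nonpos_of_nonneg_of_nonpos (sub_nonneg.2 hxy.le)
      (sub_nonpos.2 ((one_le_div hc).2 (hs s hmem)))

theorem netGain_le_extend_left (hf : ∀ s, HasDerivAt f (f' s) s) (hc : 0 < c) (hu : u' ≤ u)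
    (hs : ∀ s ∈ Ioo u' u, f' s ≤ c) : netGain f c u v ≤ netGain f c u' v := by
  linarith [netGain_add f c u' u v, netGain_nonneg hf hc hu hs]

theorem netGain_le_shrink_left (hf : ∀ s, HasDerivAt f (f' s) s) (hc : 0 < c) (hu : u ≤ u')
    (hs : ∀ s ∈ Ioo u u', c ≤ f' s) : netGain f c u v ≤ netGain f c u' v := by
  linarith [netGain_add f c u u' v, netGain_nonpos hf hc hu hs]

theorem netGain_le_shrink_right (hf : ∀ s, HasDerivAt f (f' s) s) (hc : 0 < c) (hv : v' ≤ v)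
    (hs : ∀ s ∈ Ioo v' v, c ≤ f' s) : netGain f c u v ≤ netGain f c u v' := by
  linarith [netGain_add f c u v' v, netGain_nonpos hf hc hv hs]

theorem netGain_lt_extend_right (hf : ∀ s, HasDerivAt f (f' s) s) (hc : 0 < c) (hv : v < v')
    (hs : ∀ s ∈ Ioo v v', f' s < c) : netGain f c u v < netGain f c u v' := by
  linarith [netGain_add f c u v v', netGain_pos hf hc hv hs]

end NetGain

/-- The function `f` has a continuous positive derivative `f'` tending to infinity: the standing
assumption under which net gains and ratios are maximized. -/
structure HasCoerciveDeriv (f f' : ℝ → ℝ) : Prop where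
  hasDerivAt : ∀ x, HasDerivAt f (f' x) x
  continuous_deriv : Continuous f'
  deriv_pos : ∀ x, 0 < f' x
  tendsto_deriv : Filter.Tendsto f' Filter.atTop Filter.atTop

namespace HasCoerciveDeriv

variable {f f' : ℝ → ℝ}

theorem continuous (hf : HasCoerciveDeriv f f') : Continuous f :=
  continuous_iff_continuousAt.2 fun x => (hf.hasDerivAt x).continuousAt

theorem strictMono (hf : HasCoerciveDeriv f f') : StrictMono f :=
  strictMono_of_hasDerivAt_pos hf.hasDerivAt hf.deriv_pos

theorem continuousOn_netGain (hf : HasCoerciveDeriv f f') {u v : ℝ → ℝ} {S : Set ℝ}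
    (hu : ContinuousOn u S) (hv : ContinuousOn v S) :
    ContinuousOn (fun x => netGain f (f' x) (u x) (v x)) S :=
  (hv.sub hu).sub (((hf.continuous.comp_continuousOn hv).sub
    (hf.continuous.comp_continuousOn hu)).div hf.continuous_deriv.continuousOn
      fun x _ => (hf.deriv_pos x).ne')

end HasCoerciveDeriv

/-! ### Intervals of maximal ratio -/

/-- The ratio `(y - x - β) / (f y - f x)` of an interval `z = (x, y)`, for a fixed cost `β`; this is
`Model.ζ` for an arbitrary function in place of `P.g`. -/
noncomputable def intervalRatio (f : ℝ → ℝ) (β : ℝ) (z : ℝ × ℝ) : ℝ :=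
  (z.2 - z.1 - β) / (f z.2 - f z.1)

/-- The maximizers of `intervalRatio f β` over `Model.D β`; for `f = P.g` this is `P.M β`. -/
def ratioMaximizers (f : ℝ → ℝ) (β : ℝ) : Set (ℝ × ℝ) :=
  {z | z ∈ Model.D β ∧ ∀ w ∈ Model.D β, intervalRatio f β w ≤ intervalRatio f β z}

section RatioMaximizers

variable {f f' : ℝ → ℝ} {β c k x y : ℝ} {z : ℝ × ℝ}

theorem fst_lt_snd_of_mem_D (hβ : 0 < β) (hz : z ∈ Model.D β) : z.1 < z.2 :=
  (lt_add_of_pos_right _ hβ).trans_le hz.2.2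

theorem isClosed_D (β : ℝ) : IsClosed (Model.D β) :=
  (isClosed_le continuous_const continuous_fst).inter
    ((isClosed_le continuous_const continuous_snd).inter
      (isClosed_le (continuous_fst.add continuous_const) continuous_snd))

theorem zero_two_mul_mem_D (hβ : 0 < β) : ((0 : ℝ), 2 * β) ∈ Model.D β :=
  ⟨le_rfl, by positivity, by linarith⟩

theorem intervalRatio_zero_two_mul_pos (hf : StrictMono f) (hβ : 0 < β) :
    0 < intervalRatio f β (0, 2 * β) :=
  div_pos (by linarith) (sub_pos.2 (hf (by linarith)))

theorem continuousOn_intervalRatio (hf : StrictMono f) (hcont : Continuous f) (hβ : 0 < β) :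
    ContinuousOn (intervalRatio f β) (Model.D β) :=
  ContinuousOn.div (by fun_prop) (by fun_prop)
    fun _ hz => (sub_pos.2 (hf (fst_lt_snd_of_mem_D hβ hz))).ne'

theorem intervalRatio_le_one_div_iff (hf : StrictMono f) (hβ : 0 < β)
    (hz : z ∈ Model.D β) : intervalRatio f β z ≤ 1 / c ↔ netGain f c z.1 z.2 ≤ β := by
  rw [intervalRatio, div_le_iff₀ (sub_pos.2 (hf (fst_lt_snd_of_mem_D hβ hz))),
    one_div_mul_eq_div, netGain, sub_le_comm]

theorem intervalRatio_eq_one_div_iff (hf : StrictMono f) (hβ : 0 < β)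
    (hz : z ∈ Model.D β) : intervalRatio f β z = 1 / c ↔ netGain f c z.1 z.2 = β := by
  rw [intervalRatio, div_eq_iff (sub_pos.2 (hf (fst_lt_snd_of_mem_D hβ hz))).ne',
    one_div_mul_eq_div, netGain]
  constructor <;> intro h <;> linarith

theorem mul_half_le_sub_of_le_deriv (hf : ∀ s, HasDerivAt f (f' s) s) (hmono : Monotone f)
    (hk0 : 0 ≤ k) (hx : 0 ≤ x) (hxy : x < y) (hk : ∀ s, y / 2 ≤ s → k ≤ f' s) :
    k * ((y - x) / 2) ≤ f y - f x := by
  have hw : max x (y / 2) < y := max_lt hxy (by linarith)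
  obtain ⟨s, hs, e⟩ := exists_sub_eq_deriv_mul hf hw
  have hlen : (y - x) / 2 ≤ y - max x (y / 2) :=
    le_sub_comm.1 (max_le (by linarith) (by linarith))
  calc k * ((y - x) / 2)
      ≤ f' s * (y - max x (y / 2)) :=
        mul_le_mul (hk s ((le_max_right _ _).trans hs.1.le)) hlen (by linarith)
          (hk0.trans (hk s ((le_max_right _ _).trans hs.1.le)))
    _ = f y - f (max x (y / 2)) := e.symm
    _ ≤ f y - f x := sub_le_sub_left (hmono (le_max_left _ _)) _

theorem exists_intervalRatio_le_of_snd_gt (hf : HasCoerciveDeriv f f') (hβ : 0 < β) {ε : ℝ}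
    (hε : 0 < ε) : ∃ R, ∀ z ∈ Model.D β, R < z.2 → intervalRatio f β z ≤ ε := by
  obtain ⟨R, hR⟩ := Filter.eventually_atTop.1 (hf.tendsto_deriv.eventually_ge_atTop (2 / ε))
  refine ⟨2 * R, fun z hz hzR => ?_⟩
  have hlt := fst_lt_snd_of_mem_D hβ hz
  rw [intervalRatio, div_le_iff₀ (sub_pos.2 (hf.strictMono hlt))]
  calc z.2 - z.1 - β
      ≤ z.2 - z.1 := sub_le_self _ hβ.le
    _ = ε * (2 / ε * ((z.2 - z.1) / 2)) := by field_simp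
    _ ≤ ε * (f z.2 - f z.1) := mul_le_mul_of_nonneg_left
      (mul_half_le_sub_of_le_deriv hf.hasDerivAt hf.strictMono.monotone (by positivity) hz.1 hlt
        fun s hs => hR s (by linarith)) hε.le

theorem ratioMaximizers_nonempty (hf : HasCoerciveDeriv f f') (hβ : 0 < β) :
    (ratioMaximizers f β).Nonempty := by
  obtain ⟨R, hR⟩ := exists_intervalRatio_le_of_snd_gt hf hβ
    (intervalRatio_zero_two_mul_pos hf.strictMono hβ)
  refine (continuousOn_intervalRatio hf.strictMono hf.continuous hβ).exists_isMaxOn'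
    (isClosed_D β) (zero_two_mul_mem_D hβ) ?_
  rw [Filter.eventually_inf_principal]
  filter_upwards [(isCompact_Icc (a := (0 : ℝ)) (b := R)).prod
    (isCompact_Icc (a := (0 : ℝ)) (b := R)) |>.compl_mem_cocompact] with z hz hzD
  refine hR z hzD (not_le.1 fun hle => hz ⟨⟨hzD.1, ?_⟩, hzD.2.1, hle⟩)
  exact (fst_lt_snd_of_mem_D hβ hzD).le.trans hle

/-- The level `c` is the reciprocal of the maximal ratio: no interval has net gain above `β` at
level `c`, and the maximizers are the intervals whose net gain is `β`. -/
structure IsOptimalLevel (f : ℝ → ℝ) (β c : ℝ) : Prop where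
  pos : 0 < c
  netGain_le : ∀ ⦃x y⦄, 0 ≤ x → x ≤ y → netGain f c x y ≤ β
  mem_iff : ∀ z, z ∈ ratioMaximizers f β ↔ 0 ≤ z.1 ∧ z.1 ≤ z.2 ∧ netGain f c z.1 z.2 = β

theorem isOptimalLevel_of_mem_ratioMaximizers (hf : StrictMono f) (hβ : 0 < β)
    (hz : z ∈ ratioMaximizers f β) : IsOptimalLevel f β (1 / intervalRatio f β z) := by
  have hpos : 0 < 1 / intervalRatio f β z := one_div_pos.2
    ((intervalRatio_zero_two_mul_pos hf hβ).trans_le (hz.2 _ (zero_two_mul_mem_D hβ)))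
  have mem_D_of_gain {x y : ℝ} (hx : 0 ≤ x) (hxy : x ≤ y)
      (h : β ≤ netGain f (1 / intervalRatio f β z) x y) : (x, y) ∈ Model.D β :=
    ⟨hx, hx.trans hxy, le_sub_iff_add_le'.1 (h.trans (netGain_le_length hf.monotone hpos hxy))⟩
  refine ⟨hpos, fun x y hx hxy => ?_, fun w => ⟨fun hw => ?_, fun ⟨hx, hxy, h⟩ => ?_⟩⟩
  · by_contra! h
    have hmem := mem_D_of_gain hx hxy h.le
    exact h.not_ge ((intervalRatio_le_one_div_iff hf hβ hmem).1
      ((one_div_one_div (intervalRatio f β z)).symm ▸ hz.2 _ hmem))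
  · refine ⟨hw.1.1, (fst_lt_snd_of_mem_D hβ hw.1).le, ?_⟩
    rw [← intervalRatio_eq_one_div_iff hf hβ hw.1, one_div_one_div]
    exact le_antisymm (hz.2 _ hw.1) (hw.2 _ hz.1)
  · have hmem := mem_D_of_gain hx hxy h.ge
    have e : intervalRatio f β w = intervalRatio f β z := by
      rw [(intervalRatio_eq_one_div_iff hf hβ hmem).2 h, one_div_one_div]
    exact ⟨hmem, fun v hv => e ▸ hz.2 v hv⟩

theorem exists_isOptimalLevel (hf : HasCoerciveDeriv f f') (hβ : 0 < β) :
    ∃ c, IsOptimalLevel f β c :=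
  (ratioMaximizers_nonempty hf hβ).elim
    fun _ hz => ⟨_, isOptimalLevel_of_mem_ratioMaximizers hf.strictMono hβ hz⟩

theorem IsOptimalLevel.le_of_netGain_eq (hc : IsOptimalLevel f β c) (hf : StrictMono f)
    (hβ : 0 < β) {d : ℝ} (hd : 0 < d) (hx : 0 ≤ x) (hxy : x ≤ y) (e : netGain f d x y = β) :
    c ≤ d := by
  by_contra! hlt
  have hne : x < y := hxy.lt_of_ne (by rintro rfl; exact hβ.ne ((netGain_self f d x).symm.trans e))
  exact (e ▸ netGain_lt_of_level_lt hf hd hlt hne).not_ge (hc.netGain_le hx hxy)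

end RatioMaximizers

/-! ### The ends of an interval of maximal net gain -/

/-- The interval `[x, y]` in `[0, ∞)` is nondegenerate and has the largest net gain at the positive
level `c`. -/
structure IsOptimalInterval (f : ℝ → ℝ) (c x y : ℝ) : Prop where
  level_pos : 0 < c
  nonneg : 0 ≤ x
  lt : x < y
  netGain_le : ∀ ⦃u v⦄, 0 ≤ u → u ≤ v → netGain f c u v ≤ netGain f c x y

theorem IsOptimalLevel.isOptimalInterval {f : ℝ → ℝ} {β c x y : ℝ} (hc : IsOptimalLevel f β c)
    (hβ : 0 < β) (hz : (x, y) ∈ ratioMaximizers f β) : IsOptimalInterval f c x y := by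
  obtain ⟨hx, -, e⟩ := (hc.mem_iff _).1 hz
  exact ⟨hc.pos, hx, fst_lt_snd_of_mem_D hβ hz.1, fun u v hu huv => e.symm ▸ hc.netGain_le hu huv⟩

namespace IsOptimalInterval

variable {f f' : ℝ → ℝ} {c d p q w x y : ℝ}

theorem netGain_right_nonpos (h : IsOptimalInterval f c x y) (hw : y ≤ w) :
    netGain f c y w ≤ 0 := by
  linarith [h.netGain_le h.nonneg (h.lt.le.trans hw), netGain_add f c x y w]

theorem netGain_suffix_nonneg (h : IsOptimalInterval f c x y) (hw : x ≤ w) :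
    0 ≤ netGain f c w y := by
  linarith [h.netGain_le h.nonneg hw, netGain_add f c x w y]

theorem netGain_left_nonpos (h : IsOptimalInterval f c x y) (hw0 : 0 ≤ w) (hw : w ≤ x) :
    netGain f c w x ≤ 0 := by
  linarith [h.netGain_le hw0 (hw.trans h.lt.le), netGain_add f c w x y]

theorem netGain_prefix_nonneg (h : IsOptimalInterval f c x y) (hw : x ≤ w) (hwy : w ≤ y) :
    0 ≤ netGain f c x w := by
  linarith [h.netGain_le (h.nonneg.trans hw) hwy, netGain_add f c x w y]

theorem deriv_right_eq (h : IsOptimalInterval f c x y) (hd : HasDerivAt f d y) : d = c := by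
  have gain : HasDerivAt (fun w => netGain f c x w) (1 - d / c) y :=
    ((hasDerivAt_id y).sub_const x).sub ((hd.sub_const (f x)).div_const c)
  have hmax : IsLocalMax (fun w => netGain f c x w) y := by
    filter_upwards [Ioi_mem_nhds h.lt] with w hw using h.netGain_le h.nonneg (le_of_lt hw)
  have := sub_eq_zero.1 (hmax.hasDerivAt_eq_zero gain)
  exact (div_eq_one_iff_eq h.level_pos.ne').1 this.symm

theorem deriv_left_eq (h : IsOptimalInterval f c x y) (hd : HasDerivAt f d x) (hx : 0 < x) :
    d = c := by
  have gain : HasDerivAt (fun w => netGain f c w y) (-1 - -d / c) x :=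
    ((hasDerivAt_id x).const_sub y).sub ((hd.const_sub (f y)).div_const c)
  have hmax : IsLocalMax (fun w => netGain f c w y) x := by
    filter_upwards [Ioo_mem_nhds hx h.lt] with w hw using h.netGain_le hw.1.le hw.2.le
  have := hmax.hasDerivAt_eq_zero gain
  rw [neg_div, sub_neg_eq_add, neg_add_eq_zero] at this
  exact (div_eq_one_iff_eq h.level_pos.ne').1 this.symm

theorem deriv_left_le (h : IsOptimalInterval f c x y) (hd : HasDerivAt f d x) : d ≤ c := by
  have hslope := (hasDerivWithinAt_iff_tendsto_slope' self_notMem_Ioi).1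
    (hd.hasDerivWithinAt (s := Ioi x))
  refine le_of_tendsto hslope ?_
  filter_upwards [Ioc_mem_nhdsGT h.lt] with w hw
  have := h.netGain_prefix_nonneg hw.1.le hw.2
  rw [netGain, sub_nonneg, div_le_iff₀' h.level_pos] at this
  rwa [slope_def_field, div_le_iff₀ (sub_pos.2 hw.1)]

theorem right_notMem_Icc (h : IsOptimalInterval f c x y) (hf : ∀ s, HasDerivAt f (f' s) s)
    (ha : StrictAntiOn f' (Icc p q)) (hpq : p < q) : y ∉ Icc p q := by
  intro hy
  have hc := h.deriv_right_eq (hf y)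
  rcases hy.2.lt_or_eq with hlt | rfl
  · refine (h.netGain_right_nonpos hlt.le).not_gt (netGain_pos hf h.level_pos hlt fun s hs => ?_)
    exact hc ▸ ha hy ⟨hy.1.trans hs.1.le, hs.2.le⟩ hs.1
  · refine (h.netGain_suffix_nonneg (le_max_right p x)).not_gt
      (netGain_neg hf h.level_pos (max_lt hpq h.lt) fun s hs => ?_)
    exact hc ▸ ha ⟨(le_max_left p x).trans hs.1.le, hs.2.le⟩ hy hs.2

theorem left_notMem_Ioc (h : IsOptimalInterval f c x y) (hf : ∀ s, HasDerivAt f (f' s) s)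
    (hp : 0 ≤ p) (hm : StrictMonoOn f' (Icc p q)) : x ∉ Ioc p q := by
  intro hx
  refine (h.netGain_left_nonpos hp hx.1.le).not_gt (netGain_pos hf h.level_pos hx.1 fun s hs => ?_)
  exact (hm ⟨hs.1.le, hs.2.le.trans hx.2⟩ ⟨hx.1.le, hx.2⟩ hs.2).trans_le (h.deriv_left_le (hf x))

end IsOptimalInterval

/-! ### The inverse of the first decreasing branch -/

/-- The generalized inverse of a function decreasing on `[0, m]`; `P.invL` is the case
`f' = P.g'`. Above `f' 0` its value is `0`. -/
noncomputable def descentInv (f' : ℝ → ℝ) (m c : ℝ) : ℝ := sInf {z | z ∈ Icc 0 m ∧ f' z ≤ c}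

section DescentInv

variable {f f' : ℝ → ℝ} {c d m s x y z : ℝ}

theorem descentInv_eq (ha : StrictAntiOn f' (Icc 0 m)) (hz : z ∈ Icc 0 m)
    (e : f' z = min c (f' 0)) : descentInv f' m c = z := by
  refine IsLeast.csInf_eq ⟨⟨hz, e.trans_le (min_le_left _ _)⟩, fun w hw => ?_⟩
  rw [← ha.le_iff_ge hw.1 hz, e]
  exact le_min hw.2 (ha.antitoneOn (left_mem_Icc.2 (hw.1.1.trans hw.1.2)) hw.1 hw.1.1)

theorem descentInv_mem_and_apply (ha : StrictAntiOn f' (Icc 0 m))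
    (hf' : ContinuousOn f' (Icc 0 m)) (hm : 0 ≤ m) (hc : f' m ≤ c) :
    descentInv f' m c ∈ Icc 0 m ∧ f' (descentInv f' m c) = min c (f' 0) := by
  have h0 : f' m ≤ f' 0 := ha.antitoneOn (left_mem_Icc.2 hm) (right_mem_Icc.2 hm) hm
  obtain ⟨z, hz, e⟩ := intermediate_value_Icc' hm hf'
    (show min c (f' 0) ∈ Icc (f' m) (f' 0) from ⟨le_min hc h0, min_le_right _ _⟩)
  rw [descentInv_eq ha hz e]
  exact ⟨hz, e⟩

theorem descentInv_mem (ha : StrictAntiOn f' (Icc 0 m)) (hf' : ContinuousOn f' (Icc 0 m))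
    (hm : 0 ≤ m) (hc : f' m ≤ c) : descentInv f' m c ∈ Icc 0 m :=
  (descentInv_mem_and_apply ha hf' hm hc).1

theorem apply_descentInv (ha : StrictAntiOn f' (Icc 0 m)) (hf' : ContinuousOn f' (Icc 0 m))
    (hm : 0 ≤ m) (hc : f' m ≤ c) : f' (descentInv f' m c) = min c (f' 0) :=
  (descentInv_mem_and_apply ha hf' hm hc).2

theorem descentInv_self (ha : StrictAntiOn f' (Icc 0 m)) (hm : 0 ≤ m) :
    descentInv f' m (f' m) = m :=
  descentInv_eq ha (right_mem_Icc.2 hm) (min_eq_left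
    (ha.antitoneOn (left_mem_Icc.2 hm) (right_mem_Icc.2 hm) hm)).symm

theorem descentInv_antitone (ha : StrictAntiOn f' (Icc 0 m)) (hf' : ContinuousOn f' (Icc 0 m))
    (hm : 0 ≤ m) (hc : f' m ≤ c) (hcd : c ≤ d) : descentInv f' m d ≤ descentInv f' m c := by
  obtain ⟨hd_mem, hd_eq⟩ := descentInv_mem_and_apply ha hf' hm (hc.trans hcd)
  obtain ⟨hc_mem, hc_eq⟩ := descentInv_mem_and_apply ha hf' hm hc
  rw [← ha.le_iff_ge hc_mem hd_mem, hd_eq, hc_eq]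
  exact min_le_min_right _ hcd

theorem le_of_descentInv_le (ha : StrictAntiOn f' (Icc 0 m)) (hf' : ContinuousOn f' (Icc 0 m))
    (hm : 0 ≤ m) (hc : f' m ≤ c) (hs : descentInv f' m c ≤ s) (hsm : s ≤ m) : f' s ≤ c := by
  obtain ⟨hmem, e⟩ := descentInv_mem_and_apply ha hf' hm hc
  exact (ha.antitoneOn hmem ⟨hmem.1.trans hs, hsm⟩ hs).trans (e.trans_le (min_le_left _ _))

theorem IsOptimalInterval.descentInv_eq_left (h : IsOptimalInterval f c x y)
    (hf : ∀ s, HasDerivAt f (f' s) s) (ha : StrictAntiOn f' (Icc 0 m)) (hx : x ≤ m) :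
    descentInv f' m c = x := by
  refine descentInv_eq ha ⟨h.nonneg, hx⟩ ?_
  rcases h.nonneg.eq_or_lt with rfl | hx0
  · exact (min_eq_right (h.deriv_left_le (hf 0))).symm
  · rw [← h.deriv_left_eq (hf x) hx0, min_eq_left]
    exact ha.antitoneOn (left_mem_Icc.2 (h.nonneg.trans hx)) ⟨h.nonneg, hx⟩ h.nonneg

end DescentInv

/-- The net gain, at the level `f' x`, of the interval that ends at `x` and starts on the decreasing
branch `[0, m]` at the same level (or at `0`); `P.φ m` is the case `f = P.g`. -/
noncomputable def valleyGain (f f' : ℝ → ℝ) (m x : ℝ) : ℝ :=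
  netGain f (f' x) (descentInv f' m (f' x)) x

/-- The function `f'` decreases on `[0, m]` and increases on `[m, ∞)`. -/
structure IsValley (f' : ℝ → ℝ) (m : ℝ) : Prop where
  nonneg : 0 ≤ m
  strictAntiOn : StrictAntiOn f' (Icc 0 m)
  strictMonoOn : StrictMonoOn f' (Ici m)

section ValleyGain

variable {f f' : ℝ → ℝ} {c d m v x y β : ℝ} {z : ℝ × ℝ}

theorem HasCoerciveDeriv.netGain_descentInv_le (hf : HasCoerciveDeriv f f')
    (ha : StrictAntiOn f' (Icc 0 m)) (hm : 0 ≤ m) (hc : f' m ≤ c) (hcd : c ≤ d) :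
    netGain f d (descentInv f' m c) v ≤ netGain f d (descentInv f' m d) v := by
  have hf' := hf.continuous_deriv.continuousOn (s := Icc 0 m)
  refine netGain_le_extend_left hf.hasDerivAt ((hf.deriv_pos m).trans_le (hc.trans hcd))
    (descentInv_antitone ha hf' hm hc hcd) fun s hs => ?_
  exact le_of_descentInv_le ha hf' hm (hc.trans hcd) hs.1.le
    (hs.2.le.trans (descentInv_mem ha hf' hm hc).2)

theorem HasCoerciveDeriv.valleyGain_lt_valleyGain (hf : HasCoerciveDeriv f f')
    (ha : StrictAntiOn f' (Icc 0 m)) (hm : 0 ≤ m) (hmx : m ≤ x) (hc : f' m ≤ f' x) (hxy : x < y)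
    (hlt : ∀ s ∈ Ico x y, f' s < f' y) : valleyGain f f' m x < valleyGain f f' m y := by
  have hle : f' x ≤ f' y := (hlt x (left_mem_Ico.2 hxy)).le
  have hmem := descentInv_mem ha hf.continuous_deriv.continuousOn hm hc
  calc netGain f (f' x) (descentInv f' m (f' x)) x
      ≤ netGain f (f' y) (descentInv f' m (f' x)) x :=
        netGain_le_of_level_le hf.strictMono.monotone (hf.deriv_pos x) hle (hmem.2.trans hmx)
    _ < netGain f (f' y) (descentInv f' m (f' x)) y :=
        netGain_lt_extend_right hf.hasDerivAt (hf.deriv_pos y) hxy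
          fun s hs => hlt s (Ioo_subset_Ico_self hs)
    _ ≤ netGain f (f' y) (descentInv f' m (f' y)) y := hf.netGain_descentInv_le ha hm hc hle

theorem valleyGain_self (f : ℝ → ℝ) (ha : StrictAntiOn f' (Icc 0 m)) (hm : 0 ≤ m) :
    valleyGain f f' m m = 0 := by
  rw [valleyGain, descentInv_self ha hm, netGain_self]

namespace IsValley

theorem strictMonoOn_valleyGain (hv : IsValley f' m) (hf : HasCoerciveDeriv f f') :
    StrictMonoOn (valleyGain f f' m) (Ici m) := fun _ hx _ hy hxy =>
  hf.valleyGain_lt_valleyGain hv.strictAntiOn hv.nonneg hx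
    (hv.strictMonoOn.monotoneOn self_mem_Ici hx hx) hxy
    fun _ hs => hv.strictMonoOn (mem_Ici.2 (le_trans hx hs.1)) hy hs.2

theorem ends_of_mem_ratioMaximizers (hv : IsValley f' m) (hf : HasCoerciveDeriv f f')
    (hβ : 0 < β) (hz : (x, y) ∈ ratioMaximizers f β) :
    m ≤ y ∧ valleyGain f f' m y = β ∧ descentInv f' m (f' y) = x := by
  obtain ⟨c, hc⟩ := exists_isOptimalLevel hf hβ
  have hopt := hc.isOptimalInterval hβ hz
  have hy : m ≤ y := by
    by_contra! hlt
    have hy0 : 0 ≤ y := hopt.nonneg.trans hopt.lt.le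
    exact hopt.right_notMem_Icc hf.hasDerivAt hv.strictAntiOn (hy0.trans_lt hlt) ⟨hy0, hlt.le⟩
  have hx : x ≤ m := by
    by_contra! hlt
    exact hopt.left_notMem_Ioc hf.hasDerivAt hv.nonneg
      (hv.strictMonoOn.mono Icc_subset_Ici_self) ⟨hlt, le_rfl⟩
  have hlevel : f' y = c := hopt.deriv_right_eq (hf.hasDerivAt y)
  have hleft : descentInv f' m (f' y) = x :=
    hlevel ▸ hopt.descentInv_eq_left hf.hasDerivAt hv.strictAntiOn hx
  exact ⟨hy, by rw [valleyGain, hleft, hlevel, ((hc.mem_iff _).1 hz).2.2], hleft⟩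

theorem bijOn_valleyGain (hv : IsValley f' m) (hf : HasCoerciveDeriv f f') :
    BijOn (valleyGain f f' m) (Ici m) (Ici 0) := by
  have hmono := hv.strictMonoOn_valleyGain hf
  have hself := valleyGain_self f hv.strictAntiOn hv.nonneg
  refine ⟨fun x hx => hself ▸ hmono.monotoneOn self_mem_Ici hx hx, hmono.injOn, fun b hb => ?_⟩
  rcases (mem_Ici.1 hb).eq_or_lt with rfl | hb
  · exact ⟨m, self_mem_Ici, hself⟩
  · obtain ⟨⟨x, y⟩, hz⟩ := ratioMaximizers_nonempty hf hb
    obtain ⟨hy, e, -⟩ := hv.ends_of_mem_ratioMaximizers hf hb hz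
    exact ⟨y, hy, e⟩

theorem ratioMaximizers_eq_singleton (hv : IsValley f' m) (hf : HasCoerciveDeriv f f')
    (hβ : 0 < β) (hy : m ≤ y) (e : valleyGain f f' m y = β) :
    ratioMaximizers f β = {(descentInv f' m (f' y), y)} := by
  refine (ratioMaximizers_nonempty hf hβ).subset_singleton_iff.1 ?_
  rintro ⟨u, v⟩ hz
  obtain ⟨hv_mem, hv_gain, hu⟩ := hv.ends_of_mem_ratioMaximizers hf hβ hz
  obtain rfl : v = y :=
    (hv.strictMonoOn_valleyGain hf).injOn hv_mem hy (hv_gain.trans e.symm)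
  rw [mem_singleton_iff, hu]

end IsValley

end ValleyGain

/-! ### First nonnegative values and continuity of inverses -/

theorem isLeast_sInf_nonneg {f : ℝ → ℝ} {u v : ℝ} (huv : u ≤ v) (hf : ContinuousOn f (Icc u v))
    (hv : 0 ≤ f v) :
    IsLeast {x | x ∈ Icc u v ∧ 0 ≤ f x} (sInf {x | x ∈ Icc u v ∧ 0 ≤ f x}) :=
  (hf.preimage_isClosed_of_isClosed isClosed_Icc isClosed_Ici).isLeast_csInf
    ⟨v, right_mem_Icc.2 huv, hv⟩ ⟨u, fun _ hx => hx.1.1⟩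

theorem eq_zero_of_isLeast_nonneg {f : ℝ → ℝ} {t u v : ℝ} (hf : ContinuousOn f (Icc u v))
    (ht : IsLeast {x | x ∈ Icc u v ∧ 0 ≤ f x} t) (hut : u < t) : f t = 0 := by
  obtain ⟨⟨⟨-, htv⟩, hft⟩, hleast⟩ := ht
  have hfu : f u < 0 := by
    by_contra! h
    exact hut.not_ge (hleast ⟨left_mem_Icc.2 (hut.le.trans htv), h⟩)
  obtain ⟨s, hs, e⟩ := intermediate_value_Icc hut.le (hf.mono (Icc_subset_Icc_right htv))
    (show (0 : ℝ) ∈ Icc (f u) (f t) from ⟨hfu.le, hft⟩)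
  have hts : t ≤ s := hleast ⟨⟨hs.1, hs.2.trans htv⟩, e.ge⟩
  rwa [le_antisymm hs.2 hts] at e

theorem continuousOn_of_comp_injOn {X Y Z : Type*} [TopologicalSpace X] [TopologicalSpace Y]
    [TopologicalSpace Z] [T2Space Y] {f : X → Y} {u : Z → X} {K : Set X} {S : Set Z}
    (hK : IsCompact K) (hf : ContinuousOn f K) (hinj : InjOn f K) (hu : MapsTo u S K)
    (hfu : ContinuousOn (fun x => f (u x)) S) : ContinuousOn u S := by
  have : CompactSpace K := isCompact_iff_compactSpace.1 hK
  have hemb := (continuousOn_iff_continuous_domRestrict.1 hf).isClosedEmbedding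
    (injOn_iff_injective.1 hinj)
  have hc : Continuous (hu.restrict u S K) :=
    hemb.isInducing.continuous_iff.2 (continuousOn_iff_continuous_domRestrict.1 hfu)
  exact continuousOn_iff_continuous_domRestrict.2 (continuous_subtype_val.comp hc)

namespace Model

variable {P : Model}

/-! ### The function `g` -/

theorem abs_drift_lt_sqrt {μ q σ : ℝ} (hq : 0 < q) (hσ : 0 < σ) :
    |μ| < Real.sqrt (μ ^ 2 + 2 * q * σ ^ 2) := by
  rw [← Real.sqrt_sq_eq_abs]
  exact Real.sqrt_lt_sqrt (sq_nonneg _) (lt_add_of_pos_right _ (by positivity))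

theorem θ1p_pos (P : Model) : 0 < P.θ1p :=
  div_pos (neg_lt_iff_pos_add'.1 (neg_lt_of_abs_lt (abs_drift_lt_sqrt P.q_pos P.σp_pos)))
    (pow_pos P.σp_pos 2)

theorem θ2p_pos (P : Model) : 0 < P.θ2p :=
  div_pos (sub_pos.2 (lt_of_abs_lt (abs_drift_lt_sqrt P.q_pos P.σp_pos))) (pow_pos P.σp_pos 2)

theorem θ1m_pos (P : Model) : 0 < P.θ1m :=
  div_pos (neg_lt_iff_pos_add'.1 (neg_lt_of_abs_lt (abs_drift_lt_sqrt P.q_pos P.σm_pos)))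
    (pow_pos P.σm_pos 2)

theorem θ2m_pos (P : Model) : 0 < P.θ2m :=
  div_pos (sub_pos.2 (lt_of_abs_lt (abs_drift_lt_sqrt P.q_pos P.σm_pos))) (pow_pos P.σm_pos 2)

theorem θ2p_lt_θ1p (h : 0 < P.μp) : P.θ2p < P.θ1p :=
  div_lt_div_of_pos_right (by linarith) (pow_pos P.σp_pos 2)

theorem θ2m_lt_θ1m (h : 0 < P.μm) : P.θ2m < P.θ1m :=
  div_lt_div_of_pos_right (by linarith) (pow_pos P.σm_pos 2)

theorem cm_mul (P : Model) : P.cm * (P.θ2m + P.θ1m) = P.θ1m - P.θ1p :=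
  div_mul_cancel₀ _ (add_pos P.θ2m_pos P.θ1m_pos).ne'

theorem cp_mul (P : Model) : P.cp * (P.θ2p + P.θ1p) = P.θ2p - P.θ2m :=
  div_mul_cancel₀ _ (add_pos P.θ2p_pos P.θ1p_pos).ne'

theorem cm_lt_one (P : Model) : P.cm < 1 :=
  (div_lt_one (add_pos P.θ2m_pos P.θ1m_pos)).2 (by linarith [P.θ2m_pos, P.θ1p_pos])

theorem cp_lt_one (P : Model) : P.cp < 1 :=
  (div_lt_one (add_pos P.θ2p_pos P.θ1p_pos)).2 (by linarith [P.θ2m_pos, P.θ1p_pos])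

theorem gp_of_le {x : ℝ} (hx : x ≤ P.a) : P.gp x = Real.exp (P.θ2m * (x - P.a)) :=
  if_neg hx.not_gt

theorem gm_of_le {x : ℝ} (hx : x ≤ P.a) : P.gm x =
    P.cm * Real.exp (P.θ2m * (x - P.a)) + (1 - P.cm) * Real.exp (-P.θ1m * (x - P.a)) :=
  if_neg hx.not_gt

theorem gp_of_gt {x : ℝ} (hx : P.a < x) : P.gp x =
    (1 - P.cp) * Real.exp (P.θ2p * (x - P.a)) + P.cp * Real.exp (-P.θ1p * (x - P.a)) :=
  if_pos hx

theorem gm_of_gt {x : ℝ} (hx : P.a < x) : P.gm x = Real.exp (-P.θ1p * (x - P.a)) :=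
  if_pos hx

theorem gp_zero (P : Model) : P.gp 0 = Real.exp (-P.θ2m * P.a) := by
  rw [gp_of_le P.a_pos.le]; ring_nf

theorem gm_zero (P : Model) :
    P.gm 0 = P.cm * Real.exp (-P.θ2m * P.a) + (1 - P.cm) * Real.exp (P.θ1m * P.a) := by
  rw [gm_of_le P.a_pos.le]; ring_nf

theorem gp_zero_pos (P : Model) : 0 < P.gp 0 := P.gp_zero ▸ Real.exp_pos _

theorem gm_zero_pos (P : Model) : 0 < P.gm 0 := by
  have hexp : Real.exp (-P.θ2m * P.a) < Real.exp (P.θ1m * P.a) :=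
    Real.exp_lt_exp.2 (mul_lt_mul_of_pos_right (by linarith [P.θ1m_pos, P.θ2m_pos]) P.a_pos)
  calc 0 < Real.exp (-P.θ2m * P.a) := Real.exp_pos _
    _ = P.cm * Real.exp (-P.θ2m * P.a) + (1 - P.cm) * Real.exp (-P.θ2m * P.a) := by ring
    _ < P.cm * Real.exp (-P.θ2m * P.a) + (1 - P.cm) * Real.exp (P.θ1m * P.a) := by
      gcongr
      exact sub_pos.2 P.cm_lt_one
    _ = P.gm 0 := P.gm_zero.symm

/-- The common coefficient of the two exponentials of `g` on `(-∞, a]`. -/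
noncomputable def kL (P : Model) : ℝ := (1 - P.cm) * Real.exp ((P.θ1m - P.θ2m) * P.a)

/-- The coefficient of the growing exponential of `g` on `[a, ∞)`. -/
noncomputable def kA (P : Model) : ℝ := (1 - P.cp) * P.gm 0

/-- Minus the coefficient of the decaying exponential of `g` on `[a, ∞)`. -/
noncomputable def kB (P : Model) : ℝ := P.gp 0 - P.cp * P.gm 0

theorem kL_pos (P : Model) : 0 < P.kL :=
  mul_pos (sub_pos.2 P.cm_lt_one) (Real.exp_pos _)

theorem kA_pos (P : Model) : 0 < P.kA :=
  mul_pos (sub_pos.2 P.cp_lt_one) P.gm_zero_pos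

theorem g_of_le {x : ℝ} (hx : x ≤ P.a) :
    P.g x = P.kL * Real.exp (P.θ2m * x) + (-P.kL) * Real.exp (-P.θ1m * x) := by
  have growing : Real.exp (P.θ2m * (x - P.a)) =
      Real.exp (P.θ2m * x) * Real.exp (-P.θ2m * P.a) := by rw [← Real.exp_add]; ring_nf
  have decaying : Real.exp (-P.θ1m * (x - P.a)) =
      Real.exp (-P.θ1m * x) * Real.exp (P.θ1m * P.a) := by rw [← Real.exp_add]; ring_nf
  have coeff : Real.exp ((P.θ1m - P.θ2m) * P.a) =
      Real.exp (P.θ1m * P.a) * Real.exp (-P.θ2m * P.a) := by rw [← Real.exp_add]; ring_nf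
  rw [g, gp_of_le hx, gm_of_le hx, gm_zero, gp_zero, kL, growing, decaying, coeff]
  ring

theorem g_of_ge {x : ℝ} (hx : P.a ≤ x) :
    P.g x = P.kA * Real.exp (P.θ2p * (x - P.a)) + (-P.kB) * Real.exp (-P.θ1p * (x - P.a)) := by
  rcases hx.eq_or_lt with rfl | hx
  · rw [g, gp_of_le le_rfl, gm_of_le le_rfl, kA, kB]
    simp only [sub_self, mul_zero, Real.exp_zero]
    ring
  · rw [g, gp_of_gt hx, gm_of_gt hx, kA, kB]
    ring

theorem hasDerivAt_left (P : Model) (x : ℝ) :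
    HasDerivAt (fun x => P.kL * Real.exp (P.θ2m * x) + (-P.kL) * Real.exp (-P.θ1m * x))
      (P.kL * P.θ2m * Real.exp (P.θ2m * x) + P.kL * P.θ1m * Real.exp (-P.θ1m * x)) x :=
  (hasDerivAt_exp_pair _ _ _ _ x).congr_deriv (by ring)

theorem hasDerivAt_right (P : Model) (x : ℝ) :
    HasDerivAt (fun x => P.kA * Real.exp (P.θ2p * (x - P.a)) +
        (-P.kB) * Real.exp (-P.θ1p * (x - P.a)))
      (P.kA * P.θ2p * Real.exp (P.θ2p * (x - P.a)) +
        P.kB * P.θ1p * Real.exp (-P.θ1p * (x - P.a))) x :=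
  ((hasDerivAt_exp_pair P.kA (-P.kB) P.θ2p P.θ1p (x - P.a)).comp_sub_const x P.a).congr_deriv
    (by ring)

theorem slopes_match (P : Model) :
    P.kL * P.θ2m * Real.exp (P.θ2m * P.a) + P.kL * P.θ1m * Real.exp (-P.θ1m * P.a) =
      P.kA * P.θ2p + P.kB * P.θ1p := by
  have growing : Real.exp ((P.θ1m - P.θ2m) * P.a) * Real.exp (P.θ2m * P.a) =
      Real.exp (P.θ1m * P.a) := by rw [← Real.exp_add]; ring_nf
  have decaying : Real.exp ((P.θ1m - P.θ2m) * P.a) * Real.exp (-P.θ1m * P.a) =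
      Real.exp (-P.θ2m * P.a) := by rw [← Real.exp_add]; ring_nf
  rw [kA, kB, kL, gm_zero, gp_zero]
  linear_combination (1 - P.cm) * P.θ2m * growing + (1 - P.cm) * P.θ1m * decaying +
    (P.cm * Real.exp (-P.θ2m * P.a) + (1 - P.cm) * Real.exp (P.θ1m * P.a)) * P.cp_mul -
    Real.exp (-P.θ2m * P.a) * P.cm_mul

theorem hasDerivAt_g_of_le {x : ℝ} (hx : x ≤ P.a) : HasDerivAt P.g
    (P.kL * P.θ2m * Real.exp (P.θ2m * x) + P.kL * P.θ1m * Real.exp (-P.θ1m * x)) x := by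
  rcases hx.eq_or_lt with rfl | hx
  · have hl : HasDerivWithinAt P.g _ (Iic P.a) P.a :=
      (P.hasDerivAt_left P.a).hasDerivWithinAt.congr (fun y hy => g_of_le hy) (g_of_le le_rfl)
    have hr : HasDerivWithinAt P.g _ (Ici P.a) P.a :=
      (P.hasDerivAt_right P.a).hasDerivWithinAt.congr (fun y hy => g_of_ge hy) (g_of_ge le_rfl)
    rw [sub_self, mul_zero, mul_zero, Real.exp_zero, mul_one, mul_one, ← slopes_match] at hr
    have := hl.union hr
    rwa [Iic_union_Ici, hasDerivWithinAt_univ] at this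
  · refine (P.hasDerivAt_left x).congr_of_eventuallyEq ?_
    filter_upwards [Iio_mem_nhds hx] with y hy using g_of_le (le_of_lt hy)

theorem hasDerivAt_g_of_ge {x : ℝ} (hx : P.a ≤ x) : HasDerivAt P.g
    (P.kA * P.θ2p * Real.exp (P.θ2p * (x - P.a)) +
      P.kB * P.θ1p * Real.exp (-P.θ1p * (x - P.a))) x := by
  rcases hx.eq_or_lt with rfl | hx
  · refine (hasDerivAt_g_of_le le_rfl).congr_deriv ?_
    rw [slopes_match, sub_self, mul_zero, mul_zero, Real.exp_zero, mul_one, mul_one]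
  · refine (P.hasDerivAt_right x).congr_of_eventuallyEq ?_
    filter_upwards [Ioi_mem_nhds hx] with y hy using g_of_ge (le_of_lt hy)

theorem g'_of_le {x : ℝ} (hx : x ≤ P.a) :
    P.g' x = P.kL * P.θ2m * Real.exp (P.θ2m * x) + P.kL * P.θ1m * Real.exp (-P.θ1m * x) :=
  (hasDerivAt_g_of_le hx).deriv

theorem g'_of_ge {x : ℝ} (hx : P.a ≤ x) :
    P.g' x = P.kA * P.θ2p * Real.exp (P.θ2p * (x - P.a)) +
      P.kB * P.θ1p * Real.exp (-P.θ1p * (x - P.a)) :=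
  (hasDerivAt_g_of_ge hx).deriv

theorem hasDerivAt_g (P : Model) (x : ℝ) : HasDerivAt P.g (P.g' x) x := by
  rcases le_total x P.a with h | h
  · exact (hasDerivAt_g_of_le h).differentiableAt.hasDerivAt
  · exact (hasDerivAt_g_of_ge h).differentiableAt.hasDerivAt

theorem continuous_g' (P : Model) : Continuous P.g' := by
  have hl : ContinuousOn P.g' (Iic P.a) :=
    ContinuousOn.congr (by fun_prop) fun x hx => g'_of_le hx
  have hr : ContinuousOn P.g' (Ici P.a) :=
    ContinuousOn.congr (by fun_prop) fun x hx => g'_of_ge hx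
  have := hl.union_of_isClosed hr isClosed_Iic isClosed_Ici
  rwa [Iic_union_Ici, continuousOn_univ] at this

theorem g'_pos_of_le {x : ℝ} (hx : x ≤ P.a) : 0 < P.g' x := by
  have := P.kL_pos; have := P.θ1m_pos; have := P.θ2m_pos
  rw [g'_of_le hx]
  positivity

theorem exp_decay_le_one {x : ℝ} (hx : P.a ≤ x) : Real.exp (-P.θ1p * (x - P.a)) ≤ 1 :=
  Real.exp_le_one_iff.2
    (mul_nonpos_of_nonpos_of_nonneg (neg_nonpos.2 P.θ1p_pos.le) (sub_nonneg.2 hx))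

theorem g'_pos_of_ge {x : ℝ} (hx : P.a ≤ x) : 0 < P.g' x := by
  have hA := P.kA_pos; have h1 := P.θ1p_pos; have h2 := P.θ2p_pos
  rw [g'_of_ge hx]
  rcases le_total 0 P.kB with hB | hB
  · positivity
  · have decaying := mul_le_mul_of_nonpos_left (exp_decay_le_one hx)
      (mul_nonpos_of_nonpos_of_nonneg hB h1.le)
    rw [mul_one] at decaying
    calc 0 < P.kA * P.θ2p + P.kB * P.θ1p := by
          rw [← slopes_match, ← g'_of_le le_rfl]
          exact g'_pos_of_le le_rfl
      _ ≤ _ := add_le_add (le_mul_of_one_le_right (by positivity)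
          (Real.one_le_exp (mul_nonneg h2.le (sub_nonneg.2 hx)))) decaying

theorem tendsto_g'_atTop (P : Model) : Filter.Tendsto P.g' Filter.atTop Filter.atTop := by
  have growing : Filter.Tendsto (fun x => P.kA * P.θ2p * Real.exp (P.θ2p * (x - P.a)))
      Filter.atTop Filter.atTop :=
    (Real.tendsto_exp_atTop.comp ((Filter.tendsto_atTop_add_const_right _ (-P.a)
      Filter.tendsto_id).const_mul_atTop P.θ2p_pos)).const_mul_atTop (mul_pos P.kA_pos P.θ2p_pos)
  refine Filter.tendsto_atTop_mono' _ ?_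
    (Filter.tendsto_atTop_add_const_right _ (-|P.kB * P.θ1p|) growing)
  filter_upwards [Filter.eventually_ge_atTop P.a] with x hx
  rw [g'_of_ge hx]
  gcongr
  refine neg_le_of_abs_le ?_
  rw [abs_mul, Real.abs_exp]
  exact mul_le_of_le_one_right (abs_nonneg _) (exp_decay_le_one hx)

theorem hasCoerciveDeriv (P : Model) : HasCoerciveDeriv P.g P.g' where
  hasDerivAt := P.hasDerivAt_g
  continuous_deriv := P.continuous_g'
  deriv_pos x := (le_total x P.a).elim g'_pos_of_le g'_pos_of_ge
  tendsto_deriv := P.tendsto_g'_atTop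

/-! ### The branches of `g'` -/

theorem exp_a1 (P : Model) : Real.exp ((P.θ2m + P.θ1m) * P.a1) = (P.θ1m / P.θ2m) ^ 2 := by
  rw [a1, mul_div_cancel₀ _ (add_pos P.θ2m_pos P.θ1m_pos).ne', two_mul, Real.exp_add,
    Real.exp_log (div_pos P.θ1m_pos P.θ2m_pos), sq]

theorem a1_pos (h : 0 < P.μm) : 0 < P.a1 :=
  div_pos (mul_pos two_pos (Real.log_pos ((one_lt_div P.θ2m_pos).2 (θ2m_lt_θ1m h))))
    (add_pos P.θ2m_pos P.θ1m_pos)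

theorem left_balance_a1 (P : Model) :
    P.kL * P.θ1m * P.θ1m * Real.exp (-P.θ1m * P.a1) =
      P.kL * P.θ2m * P.θ2m * Real.exp (P.θ2m * P.a1) := by
  have h2 := P.θ2m_pos
  have hexp : Real.exp (P.θ2m * P.a1) =
      Real.exp ((P.θ2m + P.θ1m) * P.a1) * Real.exp (-P.θ1m * P.a1) := by
    rw [← Real.exp_add]; ring_nf
  rw [hexp, exp_a1]
  field_simp

theorem strictAntiOn_g'_left {m : ℝ} (h1 : m ≤ P.a1) (h2 : m ≤ P.a) :
    StrictAntiOn P.g' (Icc 0 m) :=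
  ((strictAntiOn_exp_pair (mul_pos P.kL_pos P.θ2m_pos) (mul_pos P.kL_pos P.θ1m_pos)
    P.θ2m_pos P.θ1m_pos P.left_balance_a1.ge).mono fun _ hx => hx.2.trans h1).congr
      fun _ hx => (g'_of_le (hx.2.trans h2)).symm

theorem strictMonoOn_g'_left (P : Model) : StrictMonoOn P.g' (Icc P.a1 P.a) :=
  ((strictMonoOn_exp_pair (mul_pos P.kL_pos P.θ2m_pos)
    P.θ2m_pos P.θ1m_pos P.left_balance_a1.le).mono Icc_subset_Ici_self).congr
      fun _ hx => (g'_of_le hx.2).symm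

theorem strictMonoOn_g'_right {x₀ : ℝ} (h0 : P.a ≤ x₀)
    (h : P.kB * P.θ1p * P.θ1p * Real.exp (-P.θ1p * (x₀ - P.a)) ≤
      P.kA * P.θ2p * P.θ2p * Real.exp (P.θ2p * (x₀ - P.a))) :
    StrictMonoOn P.g' (Ici x₀) := by
  intro x hx y hy hxy
  rw [g'_of_ge (h0.trans hx), g'_of_ge (h0.trans hy)]
  exact strictMonoOn_exp_pair (mul_pos P.kA_pos P.θ2p_pos) P.θ2p_pos P.θ1p_pos h
    (a := x - P.a) (b := y - P.a) (sub_le_sub_right (mem_Ici.1 hx) _)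
    (sub_le_sub_right (mem_Ici.1 hy) _) (sub_lt_sub_right hxy _)

theorem strictAntiOn_g'_right {x₀ : ℝ} (hB : 0 < P.kB)
    (h : P.kA * P.θ2p * P.θ2p * Real.exp (P.θ2p * (x₀ - P.a)) ≤
      P.kB * P.θ1p * P.θ1p * Real.exp (-P.θ1p * (x₀ - P.a))) :
    StrictAntiOn P.g' (Icc P.a x₀) := by
  intro x hx y hy hxy
  rw [g'_of_ge hx.1, g'_of_ge hy.1]
  exact strictAntiOn_exp_pair (mul_pos P.kA_pos P.θ2p_pos) (mul_pos hB P.θ1p_pos) P.θ2p_pos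
    P.θ1p_pos h (a := x - P.a) (b := y - P.a) (sub_le_sub_right hx.2 _) (sub_le_sub_right hy.2 _)
    (sub_lt_sub_right hxy _)

/-- The right second derivative of `g` at `a`. Its sign decides whether `g'` increases on
`[a, ∞)` or first decreases, down to `x₀`. -/
noncomputable def rightCurvature (P : Model) : ℝ := P.kA * P.θ2p ^ 2 - P.kB * P.θ1p ^ 2

theorem strictMonoOn_g'_Ici_a (h : 0 ≤ P.rightCurvature) : StrictMonoOn P.g' (Ici P.a) :=
  strictMonoOn_g'_right le_rfl (by simpa [sq, mul_assoc] using sub_nonneg.1 h)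

theorem kB_pos (h : P.rightCurvature ≤ 0) : 0 < P.kB :=
  pos_of_mul_pos_left ((mul_pos P.kA_pos (pow_pos P.θ2p_pos 2)).trans_le (sub_nonpos.1 h))
    (sq_nonneg _)

theorem exp_x0 (h : P.rightCurvature ≤ 0) :
    Real.exp ((P.θ2p + P.θ1p) * (P.x0 - P.a)) = P.kB * P.θ1p ^ 2 / (P.kA * P.θ2p ^ 2) := by
  rw [x0, add_sub_cancel_right, mul_div_cancel₀ _ (add_pos P.θ2p_pos P.θ1p_pos).ne']
  exact Real.exp_log (div_pos (mul_pos (kB_pos h) (pow_pos P.θ1p_pos 2))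
    (mul_pos P.kA_pos (pow_pos P.θ2p_pos 2)))

theorem right_balance_x0 (h : P.rightCurvature ≤ 0) :
    P.kB * P.θ1p * P.θ1p * Real.exp (-P.θ1p * (P.x0 - P.a)) =
      P.kA * P.θ2p * P.θ2p * Real.exp (P.θ2p * (P.x0 - P.a)) := by
  have := P.kA_pos; have := P.θ2p_pos
  have hexp : Real.exp (P.θ2p * (P.x0 - P.a)) =
      Real.exp ((P.θ2p + P.θ1p) * (P.x0 - P.a)) * Real.exp (-P.θ1p * (P.x0 - P.a)) := by
    rw [← Real.exp_add]; ring_nf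
  rw [hexp, exp_x0 h]
  field_simp

theorem a_le_x0 (h : P.rightCurvature ≤ 0) : P.a ≤ P.x0 := by
  have hexp : 1 ≤ Real.exp ((P.θ2p + P.θ1p) * (P.x0 - P.a)) := by
    rw [exp_x0 h]
    exact (one_le_div (mul_pos P.kA_pos (pow_pos P.θ2p_pos 2))).2 (sub_nonpos.1 h)
  exact sub_nonneg.1 (nonneg_of_mul_nonneg_right (Real.one_le_exp_iff.1 hexp)
    (add_pos P.θ2p_pos P.θ1p_pos))

theorem a_lt_x0 (h : P.rightCurvature < 0) : P.a < P.x0 := by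
  refine (a_le_x0 h.le).lt_of_ne fun e => h.ne ?_
  have := right_balance_x0 h.le
  rw [← e, sub_self, mul_zero, mul_zero, Real.exp_zero, mul_one, mul_one] at this
  rw [rightCurvature, sub_eq_zero, sq, sq, ← mul_assoc, ← mul_assoc, this]

theorem strictMonoOn_g'_Ici_x0 (h : P.rightCurvature ≤ 0) : StrictMonoOn P.g' (Ici P.x0) :=
  strictMonoOn_g'_right (a_le_x0 h) (right_balance_x0 h).le

theorem strictAntiOn_g'_Icc_a_x0 (h : P.rightCurvature ≤ 0) :
    StrictAntiOn P.g' (Icc P.a P.x0) :=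
  strictAntiOn_g'_right (kB_pos h) (right_balance_x0 h).ge

/-! ### The thresholds `a₂` and `a₃` -/

theorem rightCurvature_eq (P : Model) : P.rightCurvature = Real.exp (-P.θ2m * P.a) *
    ((1 - P.cm) * P.Θ * Real.exp ((P.θ1m + P.θ2m) * P.a) - (P.θ1p ^ 2 - P.cm * P.Θ)) := by
  have hexp : Real.exp (P.θ1m * P.a) =
      Real.exp ((P.θ1m + P.θ2m) * P.a) * Real.exp (-P.θ2m * P.a) := by
    rw [← Real.exp_add]; ring_nf
  rw [rightCurvature, kA, kB, Θ, gm_zero, gp_zero, hexp]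
  ring

theorem Θ_lt_θ1p_sq (h : 0 < P.μp) : P.Θ < P.θ1p ^ 2 := by
  have hsq : P.θ2p ^ 2 < P.θ1p ^ 2 := pow_lt_pow_left₀ (θ2p_lt_θ1p h) P.θ2p_pos.le two_ne_zero
  calc P.Θ < P.cp * P.θ1p ^ 2 + (1 - P.cp) * P.θ1p ^ 2 := by
        rw [Θ]
        gcongr
        exact sub_pos.2 P.cp_lt_one
    _ = P.θ1p ^ 2 := by ring

theorem cm_mul_Θ_lt_θ1p_sq (h : 0 < P.μp) (hΘ : 0 < P.Θ) : P.cm * P.Θ < P.θ1p ^ 2 :=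
  (mul_lt_of_lt_one_left hΘ P.cm_lt_one).trans (Θ_lt_θ1p_sq h)

theorem exp_a3 (h : 0 < P.μp) (hΘ : 0 < P.Θ) :
    (1 - P.cm) * P.Θ * Real.exp ((P.θ1m + P.θ2m) * P.a3) = P.θ1p ^ 2 - P.cm * P.Θ := by
  have hden : 0 < (1 - P.cm) * P.Θ := mul_pos (sub_pos.2 P.cm_lt_one) hΘ
  have hnum : (1 - P.cm * P.cp) * P.θ1p ^ 2 - (1 - P.cp) * P.cm * P.θ2p ^ 2 =
      P.θ1p ^ 2 - P.cm * P.Θ := by rw [Θ]; ring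
  rw [a3, mul_div_cancel₀ _ (add_pos P.θ1m_pos P.θ2m_pos).ne', hnum,
    Real.exp_log (div_pos (sub_pos.2 (cm_mul_Θ_lt_θ1p_sq h hΘ)) hden), mul_div_cancel₀ _ hden.ne']

theorem rightCurvature_pos_iff (h : 0 < P.μp) (hΘ : 0 < P.Θ) :
    0 < P.rightCurvature ↔ P.a3 < P.a := by
  rw [rightCurvature_eq, ← exp_a3 h hΘ, ← mul_sub,
    mul_pos_iff_of_pos_left (Real.exp_pos _),
    mul_pos_iff_of_pos_left (mul_pos (sub_pos.2 P.cm_lt_one) hΘ), sub_pos, Real.exp_lt_exp,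
    mul_lt_mul_iff_right₀ (add_pos P.θ1m_pos P.θ2m_pos)]

theorem rightCurvature_nonneg_iff (h : 0 < P.μp) (hΘ : 0 < P.Θ) :
    0 ≤ P.rightCurvature ↔ P.a3 ≤ P.a := by
  rw [rightCurvature_eq, ← exp_a3 h hΘ, ← mul_sub,
    mul_nonneg_iff_of_pos_left (Real.exp_pos _),
    mul_nonneg_iff_of_pos_left (mul_pos (sub_pos.2 P.cm_lt_one) hΘ), sub_nonneg, Real.exp_le_exp,
    mul_le_mul_iff_right₀ (add_pos P.θ1m_pos P.θ2m_pos)]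

theorem rightCurvature_neg_iff (h : 0 < P.μp) (hΘ : 0 < P.Θ) :
    P.rightCurvature < 0 ↔ P.a < P.a3 := by
  rw [← not_le, rightCurvature_nonneg_iff h hΘ, not_le]

theorem rightCurvature_nonpos_iff (h : 0 < P.μp) (hΘ : 0 < P.Θ) :
    P.rightCurvature ≤ 0 ↔ P.a ≤ P.a3 := by
  rw [← not_lt, rightCurvature_pos_iff h hΘ, not_lt]

theorem rightCurvature_neg_of_Θ_nonpos (hΘ : P.Θ ≤ 0) : P.rightCurvature < 0 :=
  calc P.rightCurvature
      = P.gm 0 * P.Θ - P.gp 0 * P.θ1p ^ 2 := by rw [rightCurvature, kA, kB, Θ]; ring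
    _ < 0 := sub_neg.2 ((mul_nonpos_of_nonneg_of_nonpos P.gm_zero_pos.le hΘ).trans_lt
      (mul_pos P.gp_zero_pos (pow_pos P.θ1p_pos 2)))

theorem Θ_pos_of_cp_pos (h : 0 < P.cp) : 0 < P.Θ :=
  add_pos (mul_pos h (pow_pos P.θ1p_pos 2))
    (mul_pos (sub_pos.2 P.cp_lt_one) (pow_pos P.θ2p_pos 2))

theorem kB_mul_eq (P : Model) : P.kB * ((P.θ2p + P.θ1p) * (P.θ2m + P.θ1m)) =
    Real.exp (-P.θ2m * P.a) * (P.θ2m + P.θ1p) *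
      ((P.θ2p + P.θ1m) - Real.exp ((P.θ1m + P.θ2m) * P.a) * (P.θ2p - P.θ2m)) := by
  have hexp : Real.exp (P.θ1m * P.a) =
      Real.exp ((P.θ1m + P.θ2m) * P.a) * Real.exp (-P.θ2m * P.a) := by
    rw [← Real.exp_add]; ring_nf
  rw [kB, gm_zero, gp_zero, hexp]
  generalize Real.exp ((P.θ1m + P.θ2m) * P.a) = E
  generalize Real.exp (-P.θ2m * P.a) = H
  linear_combination (-(H * P.cm + (1 - P.cm) * E * H) * (P.θ2m + P.θ1m)) * P.cp_mul -
    (H - E * H) * (P.θ2p - P.θ2m) * P.cm_mul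

theorem kB_nonpos_of_a2_le (h : 0 < P.cp) (ha : P.a2 ≤ P.a) : P.kB ≤ 0 := by
  have h1p := P.θ1p_pos; have h2p := P.θ2p_pos; have h1m := P.θ1m_pos; have h2m := P.θ2m_pos
  have hd : 0 < P.θ2p - P.θ2m := P.cp_mul ▸ mul_pos h (by positivity)
  have hexp : P.θ2p + P.θ1m ≤ Real.exp ((P.θ1m + P.θ2m) * P.a) * (P.θ2p - P.θ2m) := by
    rw [← div_le_iff₀ hd, ← Real.log_le_iff_le_exp (by positivity)]
    rwa [a2, div_le_iff₀' (by positivity)] at ha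
  refine nonpos_of_mul_nonpos_left (P.kB_mul_eq.trans_le ?_) (by positivity)
  exact mul_nonpos_of_nonneg_of_nonpos (by positivity) (sub_nonpos.2 hexp)

theorem rightCurvature_nonneg_of_a2_le (h : 0 < P.cp) (ha : P.a2 ≤ P.a) : 0 ≤ P.rightCurvature :=
  sub_nonneg.2 <| (mul_nonpos_of_nonpos_of_nonneg (kB_nonpos_of_a2_le h ha) (sq_nonneg _)).trans
    (mul_pos P.kA_pos (pow_pos P.θ2p_pos 2)).le

/-! ### The shape of `g'` in the four cases -/

theorem CaseI.le_a1_and_rightCurvature_nonneg (hμp : 0 < P.μp) (h : P.CaseI) :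
    P.a ≤ P.a1 ∧ 0 ≤ P.rightCurvature := by
  rcases h with ⟨-, h2, h1, hc⟩ | ⟨-, h3, h1, hc⟩ | ⟨-, h3, h1, -, hΘ⟩
  · exact ⟨h1, rightCurvature_nonneg_of_a2_le hc h2⟩
  · exact ⟨(le_min_iff.1 h1).1, (rightCurvature_nonneg_iff hμp (Θ_pos_of_cp_pos hc)).2 h3⟩
  · exact ⟨h1, (rightCurvature_nonneg_iff hμp hΘ).2 h3⟩

theorem CaseII.le_a1_and_rightCurvature_nonpos (hμp : 0 < P.μp) (h : P.CaseII) :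
    P.a ≤ P.a1 ∧ P.rightCurvature ≤ 0 := by
  rcases h with ⟨h, hc⟩ | ⟨h1, -, hΘ⟩ | ⟨h, -, hΘ⟩
  · exact ⟨(le_min_iff.1 (le_min_iff.1 h).1).1,
      (rightCurvature_nonpos_iff hμp (Θ_pos_of_cp_pos hc)).2 (le_min_iff.1 h).2⟩
  · exact ⟨h1, (rightCurvature_neg_of_Θ_nonpos hΘ).le⟩
  · exact ⟨(le_min_iff.1 h).1, (rightCurvature_nonpos_iff hμp hΘ).2 (le_min_iff.1 h).2⟩

theorem CaseIII.a1_le_and_rightCurvature_nonneg (hμp : 0 < P.μp) (h : P.CaseIII) :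
    P.a1 ≤ P.a ∧ 0 ≤ P.rightCurvature := by
  rcases h with ⟨h, hc⟩ | ⟨h, -, hc⟩ | ⟨h, -, hΘ⟩
  · exact ⟨(max_le_iff.1 h).1, rightCurvature_nonneg_of_a2_le hc (max_le_iff.1 h).2⟩
  · exact ⟨(max_le_iff.1 h).1,
      (rightCurvature_nonneg_iff hμp (Θ_pos_of_cp_pos hc)).2 (max_le_iff.1 h).2⟩
  · exact ⟨(max_le_iff.1 h).1, (rightCurvature_nonneg_iff hμp hΘ).2 (max_le_iff.1 h).2⟩

theorem CaseIV.a1_lt_and_rightCurvature_neg (hμp : 0 < P.μp) (h : P.CaseIV) :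
    P.a1 < P.a ∧ P.rightCurvature < 0 := by
  rcases h with ⟨h1, h2, hc⟩ | ⟨h1, -, hΘ⟩ | ⟨h1, h3, -, hΘ⟩
  · exact ⟨h1, (rightCurvature_neg_iff hμp (Θ_pos_of_cp_pos hc)).2 (lt_min_iff.1 h2).2⟩
  · exact ⟨h1, rightCurvature_neg_of_Θ_nonpos hΘ⟩
  · exact ⟨h1, (rightCurvature_neg_iff hμp hΘ).2 h3⟩

theorem CaseI.isValley (hμp : 0 < P.μp) (h : P.CaseI) : IsValley P.g' P.a := by
  obtain ⟨h1, hcurv⟩ := h.le_a1_and_rightCurvature_nonneg hμp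
  exact ⟨P.a_pos.le, strictAntiOn_g'_left h1 le_rfl, strictMonoOn_g'_Ici_a hcurv⟩

theorem CaseII.isValley (hμp : 0 < P.μp) (h : P.CaseII) : IsValley P.g' P.x0 := by
  obtain ⟨h1, hcurv⟩ := h.le_a1_and_rightCurvature_nonpos hμp
  have hax := a_le_x0 hcurv
  refine ⟨P.a_pos.le.trans hax, ?_, strictMonoOn_g'_Ici_x0 hcurv⟩
  rw [← Icc_union_Icc_eq_Icc P.a_pos.le hax]
  exact (strictAntiOn_g'_left h1 le_rfl).union (strictAntiOn_g'_Icc_a_x0 hcurv)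
    (isGreatest_Icc P.a_pos.le) (isLeast_Icc hax)

theorem CaseIII.isValley (hμp : 0 < P.μp) (hμm : 0 < P.μm) (h : P.CaseIII) :
    IsValley P.g' P.a1 := by
  obtain ⟨h1, hcurv⟩ := h.a1_le_and_rightCurvature_nonneg hμp
  refine ⟨(a1_pos hμm).le, strictAntiOn_g'_left le_rfl h1, ?_⟩
  rw [← Icc_union_Ici_eq_Ici h1]
  exact P.strictMonoOn_g'_left.union (strictMonoOn_g'_Ici_a hcurv) (isGreatest_Icc h1)
    isLeast_Ici

/-- The function `g'` decreases on `[0, a₁]`, increases on `[a₁, a]`, decreases on `[a, x₀]` and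
increases on `[x₀, ∞)`. -/
structure TwoValleys (P : Model) : Prop where
  a1_pos : 0 < P.a1
  a1_lt_a : P.a1 < P.a
  a_lt_x0 : P.a < P.x0
  strictAntiOn_first : StrictAntiOn P.g' (Icc 0 P.a1)
  strictMonoOn_first : StrictMonoOn P.g' (Icc P.a1 P.a)
  strictAntiOn_second : StrictAntiOn P.g' (Icc P.a P.x0)
  strictMonoOn_second : StrictMonoOn P.g' (Ici P.x0)

theorem CaseIV.twoValleys (hμp : 0 < P.μp) (hμm : 0 < P.μm) (h : P.CaseIV) : P.TwoValleys := by
  obtain ⟨h1, hcurv⟩ := h.a1_lt_and_rightCurvature_neg hμp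
  exact {
    a1_pos := a1_pos hμm
    a1_lt_a := h1
    a_lt_x0 := a_lt_x0 hcurv
    strictAntiOn_first := strictAntiOn_g'_left le_rfl h1.le
    strictMonoOn_first := P.strictMonoOn_g'_left
    strictAntiOn_second := strictAntiOn_g'_Icc_a_x0 hcurv.le
    strictMonoOn_second := strictMonoOn_g'_Ici_x0 hcurv.le }

/-! ### One valley -/

theorem integral_eq_netGain (P : Model) (c x y : ℝ) :
    ∫ s in x..y, (1 - P.g' s / c) = netGain P.g c x y :=
  integral_one_sub_div_eq_netGain P.hasDerivAt_g P.continuous_g' c x y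

theorem φ_eq_valleyGain (P : Model) (m : ℝ) : P.φ m = valleyGain P.g P.g' m :=
  funext fun _ => P.integral_eq_netGain _ _ _

theorem bijOn_φ {m : ℝ} (h : IsValley P.g' m) : BijOn (P.φ m) (Ici m) (Ici 0) :=
  P.φ_eq_valleyGain m ▸ h.bijOn_valleyGain P.hasCoerciveDeriv

theorem M_eq_singleton {m β : ℝ} (h : IsValley P.g' m) (hβ : 0 < β) :
    P.M β = {(P.invL m (P.g' (P.φinv m β)), P.φinv m β)} := by
  obtain ⟨y, hy, e⟩ := (bijOn_φ h).surjOn hβ.le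
  refine h.ratioMaximizers_eq_singleton P.hasCoerciveDeriv hβ
    (Function.invFunOn_mem ⟨y, hy, e⟩) ?_
  rw [← φ_eq_valleyGain]
  exact Function.invFunOn_eq ⟨y, hy, e⟩

end Model

namespace Model

variable {P : Model}

/-! ### Two valleys: the branches of `g'` -/

namespace TwoValleys

variable {c d s x y : ℝ}

theorem bijOn_firstAscent (H : P.TwoValleys) :
    BijOn P.g' (Icc P.a1 P.a) (Icc (P.g' P.a1) (P.g' P.a)) :=
  ⟨H.strictMonoOn_first.monotoneOn.mapsTo_Icc, H.strictMonoOn_first.injOn,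
    intermediate_value_Icc H.a1_lt_a.le P.continuous_g'.continuousOn⟩

theorem bijOn_secondDescent (H : P.TwoValleys) :
    BijOn P.g' (Icc P.a P.x0) (Icc (P.g' P.x0) (P.g' P.a)) :=
  ⟨H.strictAntiOn_second.antitoneOn.mapsTo_Icc, H.strictAntiOn_second.injOn,
    intermediate_value_Icc' H.a_lt_x0.le P.continuous_g'.continuousOn⟩

theorem bijOn_secondAscent (H : P.TwoValleys) : BijOn P.g' (Ici P.x0) (Ici (P.g' P.x0)) := by
  refine ⟨fun x hx => H.strictMonoOn_second.monotoneOn self_mem_Ici hx hx,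
    H.strictMonoOn_second.injOn, fun c hc => ?_⟩
  obtain ⟨z, hcz, hz⟩ := ((P.tendsto_g'_atTop.eventually_ge_atTop c).and
    (Filter.eventually_ge_atTop P.x0)).exists
  obtain ⟨s, hs, e⟩ := intermediate_value_Icc hz P.continuous_g'.continuousOn ⟨hc, hcz⟩
  exact ⟨s, hs.1, e⟩

theorem g'_a1_lt (H : P.TwoValleys) : P.g' P.a1 < P.g' P.a :=
  H.strictMonoOn_first (left_mem_Icc.2 H.a1_lt_a.le) (right_mem_Icc.2 H.a1_lt_a.le) H.a1_lt_a

theorem g'_x0_lt (H : P.TwoValleys) : P.g' P.x0 < P.g' P.a :=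
  H.strictAntiOn_second (left_mem_Icc.2 H.a_lt_x0.le) (right_mem_Icc.2 H.a_lt_x0.le) H.a_lt_x0

theorem g'_lt_g' (H : P.TwoValleys) (hx : P.x0 ≤ x) (hxy : x < y) : P.g' x < P.g' y :=
  H.strictMonoOn_second hx (hx.trans hxy.le) hxy

theorem g'_le_g' (H : P.TwoValleys) (hx : P.x0 ≤ x) (hxy : x ≤ y) : P.g' x ≤ P.g' y :=
  H.strictMonoOn_second.monotoneOn hx (hx.trans hxy) hxy

theorem lt_of_g'_lt (H : P.TwoValleys) (hx : P.x0 ≤ x) (hy : P.x0 ≤ y) (h : P.g' x < P.g' y) :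
    x < y := (H.strictMonoOn_second.lt_iff_lt hx hy).1 h

theorem a1_le_of_x0_le (H : P.TwoValleys) (hx : P.x0 ≤ x) : P.a1 ≤ x :=
  (H.a1_lt_a.trans H.a_lt_x0).le.trans hx

theorem inv1_mem (H : P.TwoValleys) (hc : P.g' P.a1 ≤ c) : P.inv1 c ∈ Icc 0 P.a1 :=
  descentInv_mem H.strictAntiOn_first P.continuous_g'.continuousOn H.a1_pos.le hc

theorem g'_inv1 (H : P.TwoValleys) (hc : P.g' P.a1 ≤ c) : P.g' (P.inv1 c) = min c (P.g' 0) :=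
  apply_descentInv H.strictAntiOn_first P.continuous_g'.continuousOn H.a1_pos.le hc

theorem inv1_g'_a1 (H : P.TwoValleys) : P.inv1 (P.g' P.a1) = P.a1 :=
  descentInv_self H.strictAntiOn_first H.a1_pos.le

theorem continuousOn_inv1 (H : P.TwoValleys) : ContinuousOn P.inv1 (Ici (P.g' P.a1)) :=
  continuousOn_of_comp_injOn isCompact_Icc P.continuous_g'.continuousOn H.strictAntiOn_first.injOn
    (fun _ hc => H.inv1_mem hc)
    ((continuousOn_id.inf continuousOn_const).congr fun _ hc => H.g'_inv1 hc)

theorem inv2_mem (H : P.TwoValleys) (hc : c ∈ Icc (P.g' P.a1) (P.g' P.a)) :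
    P.inv2 c ∈ Icc P.a1 P.a := H.bijOn_firstAscent.surjOn.mapsTo_invFunOn hc

theorem g'_inv2 (H : P.TwoValleys) (hc : c ∈ Icc (P.g' P.a1) (P.g' P.a)) :
    P.g' (P.inv2 c) = c := H.bijOn_firstAscent.surjOn.rightInvOn_invFunOn hc

theorem inv2_g' (H : P.TwoValleys) (hx : x ∈ Icc P.a1 P.a) : P.inv2 (P.g' x) = x :=
  H.bijOn_firstAscent.injOn.leftInvOn_invFunOn hx

theorem lt_g'_of_inv2_lt (H : P.TwoValleys) (hc : c ∈ Icc (P.g' P.a1) (P.g' P.a))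
    (hs : P.inv2 c < s) (hsa : s ≤ P.a) : c < P.g' s := by
  have hmem := H.inv2_mem hc
  exact (H.g'_inv2 hc).symm.trans_lt (H.strictMonoOn_first hmem ⟨hmem.1.trans hs.le, hsa⟩ hs)

theorem inv2_le_inv2 (H : P.TwoValleys) (hc : c ∈ Icc (P.g' P.a1) (P.g' P.a))
    (hd : d ∈ Icc (P.g' P.a1) (P.g' P.a)) (hcd : c ≤ d) : P.inv2 c ≤ P.inv2 d := by
  rwa [← H.strictMonoOn_first.le_iff_le (H.inv2_mem hc) (H.inv2_mem hd), H.g'_inv2 hc,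
    H.g'_inv2 hd]

theorem continuousOn_inv2 (H : P.TwoValleys) :
    ContinuousOn P.inv2 (Icc (P.g' P.a1) (P.g' P.a)) :=
  continuousOn_of_comp_injOn isCompact_Icc P.continuous_g'.continuousOn H.strictMonoOn_first.injOn
    (fun _ hc => H.inv2_mem hc) (continuousOn_id.congr fun _ hc => H.g'_inv2 hc)

theorem inv3_mem (H : P.TwoValleys) (hc : c ∈ Icc (P.g' P.x0) (P.g' P.a)) :
    P.inv3 c ∈ Icc P.a P.x0 := H.bijOn_secondDescent.surjOn.mapsTo_invFunOn hc

theorem g'_inv3 (H : P.TwoValleys) (hc : c ∈ Icc (P.g' P.x0) (P.g' P.a)) :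
    P.g' (P.inv3 c) = c := H.bijOn_secondDescent.surjOn.rightInvOn_invFunOn hc

theorem inv3_g' (H : P.TwoValleys) (hx : x ∈ Icc P.a P.x0) : P.inv3 (P.g' x) = x :=
  H.bijOn_secondDescent.injOn.leftInvOn_invFunOn hx

theorem lt_g'_of_lt_inv3 (H : P.TwoValleys) (hc : c ∈ Icc (P.g' P.x0) (P.g' P.a))
    (has : P.a ≤ s) (hs : s < P.inv3 c) : c < P.g' s := by
  have hmem := H.inv3_mem hc
  exact (H.g'_inv3 hc).symm.trans_lt (H.strictAntiOn_second ⟨has, hs.le.trans hmem.2⟩ hmem hs)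

theorem g'_le_of_inv3_le (H : P.TwoValleys) (hc : c ∈ Icc (P.g' P.x0) (P.g' P.a))
    (hs : P.inv3 c ≤ s) (hsx : s ≤ P.x0) : P.g' s ≤ c := by
  have hmem := H.inv3_mem hc
  exact (H.strictAntiOn_second.antitoneOn hmem ⟨hmem.1.trans hs, hsx⟩ hs).trans_eq (H.g'_inv3 hc)

theorem inv3_le_inv3 (H : P.TwoValleys) (hc : c ∈ Icc (P.g' P.x0) (P.g' P.a))
    (hd : d ∈ Icc (P.g' P.x0) (P.g' P.a)) (hcd : c ≤ d) : P.inv3 d ≤ P.inv3 c := by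
  rwa [← H.strictAntiOn_second.le_iff_ge (H.inv3_mem hc) (H.inv3_mem hd), H.g'_inv3 hc,
    H.g'_inv3 hd]

theorem continuousOn_inv3 (H : P.TwoValleys) :
    ContinuousOn P.inv3 (Icc (P.g' P.x0) (P.g' P.a)) :=
  continuousOn_of_comp_injOn isCompact_Icc P.continuous_g'.continuousOn
    H.strictAntiOn_second.injOn (fun _ hc => H.inv3_mem hc)
    (continuousOn_id.congr fun _ hc => H.g'_inv3 hc)

theorem x0_le_inv4 (H : P.TwoValleys) (hc : P.g' P.x0 ≤ c) : P.x0 ≤ P.inv4 c :=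
  H.bijOn_secondAscent.surjOn.mapsTo_invFunOn hc

theorem g'_inv4 (H : P.TwoValleys) (hc : P.g' P.x0 ≤ c) : P.g' (P.inv4 c) = c :=
  H.bijOn_secondAscent.surjOn.rightInvOn_invFunOn hc

/-! ### The points `a₅` and `a₆` -/

theorem x0_le_a6 (H : P.TwoValleys) : P.x0 ≤ P.a6 := H.x0_le_inv4 H.g'_x0_lt.le

theorem g'_a6 (H : P.TwoValleys) : P.g' P.a6 = P.g' P.a := H.g'_inv4 H.g'_x0_lt.le

theorem isLeast_a5 (H : P.TwoValleys) : IsLeast {x | P.x0 ≤ x ∧ P.g' P.a1 ≤ P.g' x} P.a5 :=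
  (isClosed_Ici.inter (isClosed_Ici.preimage P.continuous_g')).isLeast_csInf
    ⟨P.a6, H.x0_le_a6, H.g'_a1_lt.le.trans_eq H.g'_a6.symm⟩ ⟨P.x0, fun _ hx => hx.1⟩

theorem x0_le_a5 (H : P.TwoValleys) : P.x0 ≤ P.a5 := H.isLeast_a5.1.1

theorem a5_le (H : P.TwoValleys) (h0 : P.x0 ≤ x) (h1 : P.g' P.a1 ≤ P.g' x) : P.a5 ≤ x :=
  H.isLeast_a5.2 ⟨h0, h1⟩

theorem a5_eq_x0_or_g'_a5_eq (H : P.TwoValleys) : P.a5 = P.x0 ∨ P.g' P.a5 = P.g' P.a1 := by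
  rcases le_total (P.g' P.a1) (P.g' P.x0) with h | h
  · exact Or.inl ((H.a5_le le_rfl h).antisymm H.x0_le_a5)
  · obtain ⟨z, hz, e⟩ := H.bijOn_secondAscent.surjOn h
    have hle : P.g' P.a5 ≤ P.g' P.a1 := (H.g'_le_g' H.x0_le_a5 (H.a5_le hz e.ge)).trans_eq e
    exact Or.inr (hle.antisymm H.isLeast_a5.1.2)

theorem a5_le_a6 (H : P.TwoValleys) : P.a5 ≤ P.a6 :=
  H.a5_le H.x0_le_a6 (H.g'_a6 ▸ H.g'_a1_lt.le)

theorem g'_a1_le (H : P.TwoValleys) (hx : P.a5 ≤ x) : P.g' P.a1 ≤ P.g' x :=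
  H.isLeast_a5.1.2.trans (H.g'_le_g' H.x0_le_a5 hx)

theorem Icc_a5_subset (H : P.TwoValleys) : Icc P.a5 P.a6 ⊆ Icc P.x0 P.a6 :=
  Icc_subset_Icc_left H.x0_le_a5

theorem g'_mem_secondDescent (H : P.TwoValleys) (hx : x ∈ Icc P.x0 P.a6) :
    P.g' x ∈ Icc (P.g' P.x0) (P.g' P.a) :=
  ⟨H.g'_le_g' le_rfl hx.1, (H.g'_le_g' hx.1 hx.2).trans_eq H.g'_a6⟩

theorem g'_mem_firstAscent (H : P.TwoValleys) (hx : x ∈ Icc P.a5 P.a6) :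
    P.g' x ∈ Icc (P.g' P.a1) (P.g' P.a) :=
  ⟨H.g'_a1_le hx.1, (H.g'_mem_secondDescent (H.Icc_a5_subset hx)).2⟩

end TwoValleys

/-! ### The gains whose signs define `x₁` and `x₂` -/

/-- The net gain, at level `g' x`, from the first descent of `g'` to the second one; `x₁` is the
first point at which it is nonnegative. -/
noncomputable def gainToDescent (P : Model) (x : ℝ) : ℝ :=
  netGain P.g (P.g' x) (P.inv1 (P.g' x)) (P.inv3 (P.g' x))

/-- The net gain, at level `g' x`, from the first ascent of `g'` up to `x`; `x₂` is the first point
at which it is nonnegative. -/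
noncomputable def gainFromAscent (P : Model) (x : ℝ) : ℝ :=
  netGain P.g (P.g' x) (P.inv2 (P.g' x)) x

/-- The net gain, at level `g' x`, from the second descent of `g'` up to `x`; this is `ω₂` before
`x₁`. -/
noncomputable def gainSecondValley (P : Model) (x : ℝ) : ℝ :=
  netGain P.g (P.g' x) (P.inv3 (P.g' x)) x

theorem x1_eq_sInf (P : Model) : P.x1 = sInf {x | x ∈ Icc P.a5 P.a6 ∧ 0 ≤ P.gainToDescent x} := by
  simp only [x1, gainToDescent, integral_eq_netGain]

theorem x2_eq_sInf (P : Model) : P.x2 = sInf {x | x ∈ Icc P.a5 P.a6 ∧ 0 ≤ P.gainFromAscent x} := by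
  simp only [x2, gainFromAscent, integral_eq_netGain]

theorem ω1_eq_netGain (P : Model) (x : ℝ) :
    P.ω1 x = netGain P.g (P.g' x) (P.inv1 (P.g' x)) x :=
  P.integral_eq_netGain _ _ _

theorem ω1_eq_valleyGain (P : Model) : P.ω1 = valleyGain P.g P.g' P.a1 := P.φ_eq_valleyGain P.a1

theorem ω1_eq_gainToDescent_add (P : Model) (x : ℝ) :
    P.ω1 x = P.gainToDescent x + P.gainSecondValley x := by
  rw [ω1_eq_netGain, gainToDescent, gainSecondValley, netGain_add]

theorem ω2_of_lt {x : ℝ} (h : x < P.x1) : P.ω2 x = P.gainSecondValley x := by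
  rw [ω2, if_pos h, integral_eq_netGain, gainSecondValley]

theorem ω2_of_ge {x : ℝ} (h : P.x1 ≤ x) : P.ω2 x = P.ω1 x := by
  rw [ω2, if_neg h.not_gt, ω1]

namespace TwoValleys

variable {b x y : ℝ}

theorem ω1_eq_add_gainFromAscent (H : P.TwoValleys) (hx : x ∈ Icc P.a5 P.a6) :
    P.ω1 x = P.ω1 (P.inv2 (P.g' x)) + P.gainFromAscent x := by
  rw [ω1_eq_netGain, ω1_eq_netGain, H.g'_inv2 (H.g'_mem_firstAscent hx), gainFromAscent,
    netGain_add]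

theorem strictMonoOn_gainToDescent (H : P.TwoValleys) :
    StrictMonoOn P.gainToDescent (Icc P.a5 P.a6) := by
  intro x hx y hy hxy
  have hlevel := H.g'_lt_g' (H.Icc_a5_subset hx).1 hxy
  have hx3 := H.g'_mem_secondDescent (H.Icc_a5_subset hx)
  have hy3 := H.g'_mem_secondDescent (H.Icc_a5_subset hy)
  have ha_le := (H.inv3_mem hy3).1
  have hlt : P.inv1 (P.g' x) < P.inv3 (P.g' y) :=
    (H.inv1_mem (H.g'_a1_le hx.1)).2.trans_lt (H.a1_lt_a.trans_le ha_le)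
  calc netGain P.g (P.g' x) (P.inv1 (P.g' x)) (P.inv3 (P.g' x))
      ≤ netGain P.g (P.g' x) (P.inv1 (P.g' x)) (P.inv3 (P.g' y)) :=
        netGain_le_shrink_right P.hasDerivAt_g (P.hasCoerciveDeriv.deriv_pos x)
          (H.inv3_le_inv3 hx3 hy3 hlevel.le)
          fun _ hs => (H.lt_g'_of_lt_inv3 hx3 (ha_le.trans hs.1.le) hs.2).le
    _ < netGain P.g (P.g' y) (P.inv1 (P.g' x)) (P.inv3 (P.g' y)) :=
        netGain_lt_of_level_lt P.hasCoerciveDeriv.strictMono (P.hasCoerciveDeriv.deriv_pos x)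
          hlevel hlt
    _ ≤ netGain P.g (P.g' y) (P.inv1 (P.g' y)) (P.inv3 (P.g' y)) :=
        P.hasCoerciveDeriv.netGain_descentInv_le H.strictAntiOn_first H.a1_pos.le
          (H.g'_a1_le hx.1) hlevel.le

theorem strictMonoOn_gainFromAscent (H : P.TwoValleys) :
    StrictMonoOn P.gainFromAscent (Icc P.a5 P.a6) := by
  intro x hx y hy hxy
  have hx0 := (H.Icc_a5_subset hx).1
  have hlevel := H.g'_lt_g' hx0 hxy
  have hx2 := H.g'_mem_firstAscent hx
  have hy2 := H.g'_mem_firstAscent hy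
  have hle_a := (H.inv2_mem hy2).2
  calc netGain P.g (P.g' x) (P.inv2 (P.g' x)) x
      ≤ netGain P.g (P.g' x) (P.inv2 (P.g' y)) x :=
        netGain_le_shrink_left P.hasDerivAt_g (P.hasCoerciveDeriv.deriv_pos x)
          (H.inv2_le_inv2 hx2 hy2 hlevel.le)
          fun _ hs => (H.lt_g'_of_inv2_lt hx2 hs.1 (hs.2.le.trans hle_a)).le
    _ ≤ netGain P.g (P.g' y) (P.inv2 (P.g' y)) x :=
        netGain_le_of_level_le P.hasCoerciveDeriv.strictMono.monotone
          (P.hasCoerciveDeriv.deriv_pos x) hlevel.le (hle_a.trans (H.a_lt_x0.le.trans hx0))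
    _ < netGain P.g (P.g' y) (P.inv2 (P.g' y)) y :=
        netGain_lt_extend_right P.hasDerivAt_g (P.hasCoerciveDeriv.deriv_pos y) hxy
          fun _ hs => H.g'_lt_g' (hx0.trans hs.1.le) hs.2

theorem strictMonoOn_gainSecondValley (H : P.TwoValleys) :
    StrictMonoOn P.gainSecondValley (Icc P.x0 P.a6) := by
  intro x hx y hy hxy
  have hlevel := H.g'_lt_g' hx.1 hxy
  have hx3 := H.g'_mem_secondDescent hx
  have hy3 := H.g'_mem_secondDescent hy
  have hle_x0 := (H.inv3_mem hx3).2
  calc netGain P.g (P.g' x) (P.inv3 (P.g' x)) x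
      ≤ netGain P.g (P.g' y) (P.inv3 (P.g' x)) x :=
        netGain_le_of_level_le P.hasCoerciveDeriv.strictMono.monotone
          (P.hasCoerciveDeriv.deriv_pos x) hlevel.le (hle_x0.trans hx.1)
    _ ≤ netGain P.g (P.g' y) (P.inv3 (P.g' y)) x :=
        netGain_le_extend_left P.hasDerivAt_g (P.hasCoerciveDeriv.deriv_pos y)
          (H.inv3_le_inv3 hx3 hy3 hlevel.le)
          fun _ hs => H.g'_le_of_inv3_le hy3 hs.1.le (hs.2.le.trans hle_x0)
    _ < netGain P.g (P.g' y) (P.inv3 (P.g' y)) y :=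
        netGain_lt_extend_right P.hasDerivAt_g (P.hasCoerciveDeriv.deriv_pos y) hxy
          fun _ hs => H.g'_lt_g' (hx.1.trans hs.1.le) hs.2

theorem continuousOn_gainToDescent (H : P.TwoValleys) :
    ContinuousOn P.gainToDescent (Icc P.a5 P.a6) :=
  P.hasCoerciveDeriv.continuousOn_netGain
    (H.continuousOn_inv1.comp P.continuous_g'.continuousOn fun _ hx => H.g'_a1_le hx.1)
    (H.continuousOn_inv3.comp P.continuous_g'.continuousOn
      fun _ hx => H.g'_mem_secondDescent (H.Icc_a5_subset hx))

theorem continuousOn_gainFromAscent (H : P.TwoValleys) :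
    ContinuousOn P.gainFromAscent (Icc P.a5 P.a6) :=
  P.hasCoerciveDeriv.continuousOn_netGain
    (H.continuousOn_inv2.comp P.continuous_g'.continuousOn fun _ hx => H.g'_mem_firstAscent hx)
    continuousOn_id

theorem gainToDescent_a6_nonneg (H : P.TwoValleys) : 0 ≤ P.gainToDescent P.a6 := by
  rw [gainToDescent, H.g'_a6, H.inv3_g' (left_mem_Icc.2 H.a_lt_x0.le)]
  refine netGain_nonneg P.hasDerivAt_g (P.hasCoerciveDeriv.deriv_pos _)
    ((H.inv1_mem H.g'_a1_lt.le).2.trans H.a1_lt_a.le) fun s hs => ?_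
  rcases le_total s P.a1 with h | h
  · exact le_of_descentInv_le H.strictAntiOn_first P.continuous_g'.continuousOn H.a1_pos.le
      H.g'_a1_lt.le hs.1.le h
  · exact (H.bijOn_firstAscent.mapsTo ⟨h, hs.2.le⟩).2

theorem gainFromAscent_a6_nonneg (H : P.TwoValleys) : 0 ≤ P.gainFromAscent P.a6 := by
  rw [gainFromAscent, H.g'_a6, H.inv2_g' (right_mem_Icc.2 H.a1_lt_a.le)]
  refine netGain_nonneg P.hasDerivAt_g (P.hasCoerciveDeriv.deriv_pos _)
    (H.a_lt_x0.le.trans H.x0_le_a6) fun s hs => ?_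
  rcases le_total s P.x0 with h | h
  · exact (H.bijOn_secondDescent.mapsTo ⟨hs.1.le, h⟩).2
  · exact (H.g'_mem_secondDescent ⟨h, hs.2.le⟩).2

theorem gainToDescent_neg_of_g'_eq (H : P.TwoValleys) (hx : x ∈ Icc P.x0 P.a6)
    (e : P.g' x = P.g' P.a1) : P.gainToDescent x < 0 := by
  have hx3 := H.g'_mem_secondDescent hx
  have hinv1 : P.inv1 (P.g' x) = P.a1 := e ▸ H.inv1_g'_a1
  rw [gainToDescent, hinv1]
  refine netGain_neg P.hasDerivAt_g (P.hasCoerciveDeriv.deriv_pos _)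
    (H.a1_lt_a.trans_le (H.inv3_mem hx3).1) fun s hs => ?_
  rcases le_total s P.a with hsa | hsa
  · exact e.trans_lt (H.strictMonoOn_first (left_mem_Icc.2 H.a1_lt_a.le) ⟨hs.1.le, hsa⟩ hs.1)
  · exact H.lt_g'_of_lt_inv3 hx3 hsa hs.2

theorem gainFromAscent_x0_neg (H : P.TwoValleys) (h : P.g' P.a1 ≤ P.g' P.x0) :
    P.gainFromAscent P.x0 < 0 := by
  have hx2 : P.g' P.x0 ∈ Icc (P.g' P.a1) (P.g' P.a) := ⟨h, H.g'_x0_lt.le⟩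
  refine netGain_neg P.hasDerivAt_g (P.hasCoerciveDeriv.deriv_pos _)
    ((H.inv2_mem hx2).2.trans_lt H.a_lt_x0) fun s hs => ?_
  rcases le_total s P.a with hsa | hsa
  · exact H.lt_g'_of_inv2_lt hx2 hs.1 hsa
  · exact H.strictAntiOn_second ⟨hsa, hs.2.le⟩ (right_mem_Icc.2 H.a_lt_x0.le) hs.2

/-! ### The points `x₁` and `x₂` -/

theorem isLeast_x1 (H : P.TwoValleys) :
    IsLeast {x | x ∈ Icc P.a5 P.a6 ∧ 0 ≤ P.gainToDescent x} P.x1 :=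
  P.x1_eq_sInf ▸
    isLeast_sInf_nonneg H.a5_le_a6 H.continuousOn_gainToDescent H.gainToDescent_a6_nonneg

theorem isLeast_x2 (H : P.TwoValleys) :
    IsLeast {x | x ∈ Icc P.a5 P.a6 ∧ 0 ≤ P.gainFromAscent x} P.x2 :=
  P.x2_eq_sInf ▸
    isLeast_sInf_nonneg H.a5_le_a6 H.continuousOn_gainFromAscent H.gainFromAscent_a6_nonneg

theorem x1_mem (H : P.TwoValleys) : P.x1 ∈ Icc P.a5 P.a6 := H.isLeast_x1.1.1

theorem x2_mem (H : P.TwoValleys) : P.x2 ∈ Icc P.a5 P.a6 := H.isLeast_x2.1.1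

theorem x0_le_x1 (H : P.TwoValleys) : P.x0 ≤ P.x1 := (H.Icc_a5_subset H.x1_mem).1

theorem x0_le_x2 (H : P.TwoValleys) : P.x0 ≤ P.x2 := (H.Icc_a5_subset H.x2_mem).1

theorem gainToDescent_x1_eq_zero (H : P.TwoValleys) (h : P.x0 < P.x1) :
    P.gainToDescent P.x1 = 0 := by
  rcases H.x1_mem.1.lt_or_eq with h5 | h5
  · exact eq_zero_of_isLeast_nonneg H.continuousOn_gainToDescent H.isLeast_x1 h5
  · have hlevel : P.g' P.x1 = P.g' P.a1 :=
      h5 ▸ H.a5_eq_x0_or_g'_a5_eq.resolve_left (h5 ▸ h).ne'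
    exact absurd H.isLeast_x1.1.2
      (H.gainToDescent_neg_of_g'_eq (H.Icc_a5_subset H.x1_mem) hlevel).not_ge

theorem g'_x2_of_eq_a5 (H : P.TwoValleys) (h : P.x2 = P.a5) : P.g' P.x2 = P.g' P.a1 := by
  rcases H.a5_eq_x0_or_g'_a5_eq with h5 | h5
  · have hx : P.x2 = P.x0 := h.trans h5
    have hnonneg := H.isLeast_x2.1.2
    rw [hx] at hnonneg
    exact absurd hnonneg (H.gainFromAscent_x0_neg (H.g'_a1_le h5.le)).not_ge
  · exact h ▸ h5

/-! ### Monotonicity of `ω₁` -/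

theorem strictMonoOn_ω1_Icc (H : P.TwoValleys) : StrictMonoOn P.ω1 (Icc P.a1 P.a) := by
  intro x hx y hy hxy
  rw [ω1_eq_valleyGain]
  exact P.hasCoerciveDeriv.valleyGain_lt_valleyGain H.strictAntiOn_first H.a1_pos.le hx.1
    (H.bijOn_firstAscent.mapsTo hx).1 hxy
    fun s hs => H.strictMonoOn_first ⟨hx.1.trans hs.1, hs.2.le.trans hy.2⟩ hy hs.2

theorem strictMonoOn_ω1_Ici (H : P.TwoValleys) : StrictMonoOn P.ω1 (Ici P.a5) := by
  intro x hx y _ hxy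
  have hx0 : P.x0 ≤ x := H.x0_le_a5.trans hx
  rw [ω1_eq_valleyGain]
  exact P.hasCoerciveDeriv.valleyGain_lt_valleyGain H.strictAntiOn_first H.a1_pos.le
    (H.a1_le_of_x0_le hx0) (H.g'_a1_le hx) hxy fun s hs => H.g'_lt_g' (hx0.trans hs.1) hs.2

theorem inv2_x2_mem (H : P.TwoValleys) : P.inv2 (P.g' P.x2) ∈ Icc P.a1 P.a :=
  H.inv2_mem (H.g'_mem_firstAscent H.x2_mem)

theorem g'_inv2_x2 (H : P.TwoValleys) : P.g' (P.inv2 (P.g' P.x2)) = P.g' P.x2 :=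
  H.g'_inv2 (H.g'_mem_firstAscent H.x2_mem)

theorem Icc_inv2_x2_subset (H : P.TwoValleys) :
    Icc P.a1 (P.inv2 (P.g' P.x2)) ⊆ Icc P.a1 P.a :=
  Icc_subset_Icc_right H.inv2_x2_mem.2

theorem Ici_x2_subset (H : P.TwoValleys) : Ici P.x2 ⊆ Ici P.a5 := Ici_subset_Ici.2 H.x2_mem.1

theorem g'_le_g'_x2 (H : P.TwoValleys) (hx : x ∈ Icc P.a1 (P.inv2 (P.g' P.x2))) :
    P.g' x ≤ P.g' P.x2 :=
  H.g'_inv2_x2 ▸ H.strictMonoOn_first.monotoneOn (H.Icc_inv2_x2_subset hx) H.inv2_x2_mem hx.2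

theorem ω1_inv2_x2_le (H : P.TwoValleys) : P.ω1 (P.inv2 (P.g' P.x2)) ≤ P.ω1 P.x2 :=
  (le_add_of_nonneg_right H.isLeast_x2.1.2).trans_eq (H.ω1_eq_add_gainFromAscent H.x2_mem).symm

theorem a1_le_of_mem_domω1 (H : P.TwoValleys) (hx : x ∈ P.domω1) : P.a1 ≤ x :=
  hx.elim And.left fun hx => H.a1_le_of_x0_le (H.x0_le_x2.trans hx)

theorem g'_a1_le_of_mem_domω1 (H : P.TwoValleys) (hx : x ∈ P.domω1) : P.g' P.a1 ≤ P.g' x :=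
  hx.elim (fun hx => (H.bijOn_firstAscent.mapsTo (H.Icc_inv2_x2_subset hx)).1)
    fun hx => H.g'_a1_le (H.Ici_x2_subset hx)

theorem ω1_lt_of_g'_lt (H : P.TwoValleys) (hx : x ∈ P.domω1) (hy : y ∈ P.domω1)
    (h : P.g' x < P.g' y) : P.ω1 x < P.ω1 y := by
  rcases hx with hx | hx <;> rcases hy with hy | hy
  · have hxa := H.Icc_inv2_x2_subset hx
    have hya := H.Icc_inv2_x2_subset hy
    exact H.strictMonoOn_ω1_Icc hxa hya ((H.strictMonoOn_first.lt_iff_lt hxa hya).1 h)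
  · rcases hx.2.lt_or_eq with hlt | rfl
    · calc P.ω1 x
          < P.ω1 (P.inv2 (P.g' P.x2)) :=
            H.strictMonoOn_ω1_Icc (H.Icc_inv2_x2_subset hx) H.inv2_x2_mem hlt
        _ ≤ P.ω1 P.x2 := H.ω1_inv2_x2_le
        _ ≤ P.ω1 y := H.strictMonoOn_ω1_Ici.monotoneOn H.x2_mem.1 (H.Ici_x2_subset hy) hy
    · rw [H.g'_inv2_x2] at h
      exact H.ω1_inv2_x2_le.trans_lt (H.strictMonoOn_ω1_Ici H.x2_mem.1 (H.Ici_x2_subset hy)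
        (H.lt_of_g'_lt H.x0_le_x2 (H.x0_le_x2.trans hy) h))
  · exact absurd h ((H.g'_le_g'_x2 hy).trans (H.g'_le_g' H.x0_le_x2 hx)).not_gt
  · exact H.strictMonoOn_ω1_Ici (H.Ici_x2_subset hx) (H.Ici_x2_subset hy)
      (H.lt_of_g'_lt (H.x0_le_x2.trans hx) (H.x0_le_x2.trans hy) h)

/-! ### The preimages under `ω₁` and `ω₂` -/

theorem x2_mem_domω1 (P : Model) : P.x2 ∈ P.domω1 := Or.inr self_mem_Ici

theorem g'_eq_of_mem_ω1inv (H : P.TwoValleys) (hx : x ∈ P.ω1inv b) (hy : y ∈ P.ω1inv b) :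
    P.g' x = P.g' y := by
  by_contra hne
  rcases lt_or_gt_of_ne hne with h | h
  · exact (H.ω1_lt_of_g'_lt hx.1 hy.1 h).ne (hx.2.trans hy.2.symm)
  · exact (H.ω1_lt_of_g'_lt hy.1 hx.1 h).ne (hy.2.trans hx.2.symm)

theorem injOn_g'_domω1_diff (H : P.TwoValleys) : InjOn P.g' (P.domω1 \ {P.x2}) := by
  have separated {u v : ℝ} (hu : u ∈ Icc P.a1 (P.inv2 (P.g' P.x2))) (hv : P.x2 ≤ v)
      (hne : v ≠ P.x2) : P.g' u < P.g' v :=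
    (H.g'_le_g'_x2 hu).trans_lt (H.g'_lt_g' H.x0_le_x2 (hv.lt_of_ne' hne))
  rintro x ⟨hx | hx, hxne⟩ y ⟨hy | hy, hyne⟩ e
  · exact H.strictMonoOn_first.injOn (H.Icc_inv2_x2_subset hx) (H.Icc_inv2_x2_subset hy) e
  · exact absurd e (separated hx hy hyne).ne
  · exact absurd e (separated hy hx hxne).ne'
  · exact H.strictMonoOn_second.injOn (H.x0_le_x2.trans hx) (H.x0_le_x2.trans hy) e

theorem ω1inv_subsingleton (H : P.TwoValleys) (hb : b ≠ P.ω1 P.x2) :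
    (P.ω1inv b).Subsingleton := by
  have ne_x2 {x : ℝ} (hx : x ∈ P.ω1inv b) : x ≠ P.x2 := fun h => hb (h ▸ hx.2.symm)
  exact fun x hx y hy => H.injOn_g'_domω1_diff ⟨hx.1, ne_x2 hx⟩ ⟨hy.1, ne_x2 hy⟩
    (H.g'_eq_of_mem_ω1inv hx hy)

theorem ω1inv_subset_pair (H : P.TwoValleys) (hb : b = P.ω1 P.x2) :
    P.ω1inv b ⊆ {P.inv2 (P.g' P.x2), P.x2} := by
  intro y hy
  have hlevel : P.g' y = P.g' P.x2 := H.g'_eq_of_mem_ω1inv hy ⟨x2_mem_domω1 P, hb.symm⟩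
  rcases eq_or_ne y P.x2 with hne | hne
  · exact Or.inr hne
  · have hinv2 : P.inv2 (P.g' P.x2) ∈ P.domω1 := Or.inl ⟨H.inv2_x2_mem.1, le_rfl⟩
    have hlt : P.inv2 (P.g' P.x2) < P.x2 :=
      H.inv2_x2_mem.2.trans_lt (H.a_lt_x0.trans_le H.x0_le_x2)
    exact Or.inl (H.injOn_g'_domω1_diff ⟨hy.1, hne⟩ ⟨hinv2, hlt.ne⟩
      (hlevel.trans H.g'_inv2_x2.symm))

theorem ω1inv_eq_pair (H : P.TwoValleys) (hb : b = P.ω1 P.x2) (h : P.a5 < P.x2) :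
    P.ω1inv b = {P.inv2 (P.g' P.x2), P.x2} := by
  have hzero : P.gainFromAscent P.x2 = 0 :=
    eq_zero_of_isLeast_nonneg H.continuousOn_gainFromAscent H.isLeast_x2 h
  refine (H.ω1inv_subset_pair hb).antisymm ?_
  rintro y (rfl | rfl)
  · refine ⟨Or.inl ⟨H.inv2_x2_mem.1, le_rfl⟩, ?_⟩
    rw [hb, H.ω1_eq_add_gainFromAscent H.x2_mem, hzero, add_zero]
  · exact ⟨x2_mem_domω1 P, hb.symm⟩

theorem ω1_a1 (H : P.TwoValleys) : P.ω1 P.a1 = 0 :=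
  P.ω1_eq_valleyGain ▸ valleyGain_self P.g H.strictAntiOn_first H.a1_pos.le

theorem ω1inv_eq_singleton (H : P.TwoValleys) (hb0 : 0 < b) (hb : b = P.ω1 P.x2)
    (h : P.x2 = P.a5) : P.ω1inv b = {P.x2} := by
  refine Subset.antisymm (fun y hy => ?_) (singleton_subset_iff.2 ⟨x2_mem_domω1 P, hb.symm⟩)
  refine (H.ω1inv_subset_pair hb hy).resolve_left fun e => hb0.ne ?_
  rw [H.g'_x2_of_eq_a5 h, H.inv2_g' (left_mem_Icc.2 H.a1_lt_a.le)] at e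
  rw [← hy.2, e, H.ω1_a1]

theorem ω2_of_le (H : P.TwoValleys) (h0 : P.x0 < x) (h1 : x ≤ P.x1) :
    P.ω2 x = P.gainSecondValley x := by
  rcases h1.lt_or_eq with h | rfl
  · exact ω2_of_lt h
  · rw [ω2_of_ge le_rfl, ω1_eq_gainToDescent_add, H.gainToDescent_x1_eq_zero h0, zero_add]

theorem strictMonoOn_ω2 (H : P.TwoValleys) : StrictMonoOn P.ω2 (Ici P.x0) := by
  intro x hx y _ hxy
  have mem_Icc {u : ℝ} (hu : P.x0 ≤ u) (h : u < P.x1) : u ∈ Icc P.x0 P.a6 :=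
    ⟨hu, h.le.trans H.x1_mem.2⟩
  rcases lt_or_ge y P.x1 with hy1 | hy1
  · rw [ω2_of_lt hy1, ω2_of_lt (hxy.trans hy1)]
    exact H.strictMonoOn_gainSecondValley (mem_Icc hx (hxy.trans hy1))
      (mem_Icc (le_trans hx hxy.le) hy1) hxy
  have hy5 : P.a5 ≤ y := H.x1_mem.1.trans hy1
  rw [ω2_of_ge hy1]
  rcases lt_or_ge x P.x1 with hx1 | hx1
  · calc P.ω2 x
        = P.gainSecondValley x := ω2_of_lt hx1
      _ < P.gainSecondValley P.x1 :=
        H.strictMonoOn_gainSecondValley (mem_Icc hx hx1) (H.Icc_a5_subset H.x1_mem) hx1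
      _ ≤ P.gainToDescent P.x1 + P.gainSecondValley P.x1 :=
        le_add_of_nonneg_left H.isLeast_x1.1.2
      _ = P.ω1 P.x1 := (P.ω1_eq_gainToDescent_add P.x1).symm
      _ ≤ P.ω1 y := H.strictMonoOn_ω1_Ici.monotoneOn H.x1_mem.1 hy5 hy1
  · rw [ω2_of_ge hx1]
    exact H.strictMonoOn_ω1_Ici (H.x1_mem.1.trans hx1) hy5 hxy

theorem ω2inv_subsingleton (H : P.TwoValleys) (b : ℝ) : (P.ω2inv b).Subsingleton :=
  fun _ hx _ hy => H.strictMonoOn_ω2.injOn hx.1 hy.1 (hx.2.trans hy.2.symm)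

theorem le_x1_iff_notMem_A3 (H : P.TwoValleys) (hx : x ∈ P.ω2inv b) :
    x ≤ P.x1 ↔ b ∉ P.A3 := by
  rw [← H.strictMonoOn_ω2.le_iff_le hx.1 H.x0_le_x1, hx.2, A3, mem_Ioi, not_lt]

end TwoValleys

end Model

namespace Model.TwoValleys

variable {P : Model}

/-! ### Intervals of maximal net gain with two valleys -/

section OptimalInterval

variable {x y : ℝ}

theorem a1_lt_right (H : P.TwoValleys) (h : IsOptimalInterval P.g (P.g' y) x y) : P.a1 < y := by
  by_contra! hle
  exact h.right_notMem_Icc P.hasDerivAt_g H.strictAntiOn_first H.a1_pos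
    ⟨h.nonneg.trans h.lt.le, hle⟩

theorem x0_lt_right (H : P.TwoValleys) (h : IsOptimalInterval P.g (P.g' y) x y)
    (hy : P.a ≤ y) : P.x0 < y := by
  by_contra! hle
  exact h.right_notMem_Icc P.hasDerivAt_g H.strictAntiOn_second H.a_lt_x0 ⟨hy, hle⟩

theorem left_le_a1_or_mem_Ioc (H : P.TwoValleys) (h : IsOptimalInterval P.g (P.g' y) x y) :
    x ≤ P.a1 ∨ x ∈ Ioc P.a P.x0 := by
  by_contra! hx
  rcases le_or_gt x P.a with hxa | hxa
  · exact h.left_notMem_Ioc P.hasDerivAt_g H.a1_pos.le H.strictMonoOn_first ⟨hx.1, hxa⟩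
  · have hx0 : P.x0 < x := not_le.1 fun hle => hx.2 ⟨hxa, hle⟩
    exact h.left_notMem_Ioc P.hasDerivAt_g (P.a_pos.trans H.a_lt_x0).le
      (H.strictMonoOn_second.mono Icc_subset_Ici_self) ⟨hx0, le_rfl⟩

theorem g'_a1_le_right (H : P.TwoValleys) (h : IsOptimalInterval P.g (P.g' y) x y)
    (hx : x ≤ P.a1) : P.g' P.a1 ≤ P.g' y :=
  (H.strictAntiOn_first.antitoneOn ⟨h.nonneg, hx⟩ (right_mem_Icc.2 H.a1_pos.le) hx).trans
    (h.deriv_left_le (P.hasDerivAt_g x))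

/-- Beyond that point, continuing up to the point `w ≥ x₂` of the same level would gain more. -/
theorem right_le_inv2_x2 (H : P.TwoValleys) (h : IsOptimalInterval P.g (P.g' y) x y)
    (hy : y < P.a) : y ≤ P.inv2 (P.g' P.x2) := by
  by_contra! hlt
  have hmem : y ∈ Icc P.a1 P.a := ⟨(H.a1_lt_right h).le, hy.le⟩
  have hlow : P.g' P.x2 < P.g' y := H.lt_g'_of_inv2_lt (H.g'_mem_firstAscent H.x2_mem) hlt hy.le
  obtain ⟨w, hw, e⟩ := H.bijOn_secondAscent.surjOn ((H.g'_le_g' le_rfl H.x0_le_x2).trans hlow.le)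
  have hx2w : P.x2 < w := H.lt_of_g'_lt H.x0_le_x2 hw (e ▸ hlow)
  have hwa6 : w ≤ P.a6 := by
    rw [← H.strictMonoOn_second.le_iff_le hw H.x0_le_a6, e, H.g'_a6]
    exact (H.bijOn_firstAscent.mapsTo hmem).2
  have hgain : 0 < P.gainFromAscent w := H.isLeast_x2.1.2.trans_lt
    (H.strictMonoOn_gainFromAscent H.x2_mem ⟨H.x2_mem.1.trans hx2w.le, hwa6⟩ hx2w)
  rw [gainFromAscent, e, H.inv2_g' hmem] at hgain
  exact hgain.not_ge (h.netGain_right_nonpos (hy.le.trans (H.a_lt_x0.le.trans hw)))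

theorem x2_le_right (H : P.TwoValleys) (h : IsOptimalInterval P.g (P.g' y) x y)
    (hx : x ≤ P.a1) (hy : P.a ≤ y) : P.x2 ≤ y := by
  rcases le_total P.a6 y with hay | hya
  · exact H.x2_mem.2.trans hay
  · have hmem : y ∈ Icc P.a5 P.a6 := ⟨H.a5_le (H.x0_lt_right h hy).le (H.g'_a1_le_right h hx), hya⟩
    exact H.isLeast_x2.2 ⟨hmem,
      h.netGain_suffix_nonneg (hx.trans (H.inv2_mem (H.g'_mem_firstAscent hmem)).1)⟩

theorem right_mem_domω1 (H : P.TwoValleys) (h : IsOptimalInterval P.g (P.g' y) x y)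
    (hx : x ≤ P.a1) : y ∈ P.domω1 :=
  (lt_or_ge y P.a).imp (fun hy => ⟨(H.a1_lt_right h).le, H.right_le_inv2_x2 h hy⟩)
    (H.x2_le_right h hx)

theorem inv1_g'_right (H : P.TwoValleys) (h : IsOptimalInterval P.g (P.g' y) x y)
    (hx : x ≤ P.a1) : P.inv1 (P.g' y) = x :=
  h.descentInv_eq_left P.hasDerivAt_g H.strictAntiOn_first hx

theorem inv3_g'_right (H : P.TwoValleys) (h : IsOptimalInterval P.g (P.g' y) x y)
    (hx : x ∈ Ioc P.a P.x0) : P.inv3 (P.g' y) = x := by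
  rw [← h.deriv_left_eq (P.hasDerivAt_g x) (P.a_pos.trans hx.1)]
  exact H.inv3_g' (Ioc_subset_Icc_self hx)

theorem right_le_a6 (H : P.TwoValleys) (h : IsOptimalInterval P.g (P.g' y) x y)
    (hx : x ∈ Ioc P.a P.x0) : y ≤ P.a6 := by
  have hy : P.x0 < y := H.x0_lt_right h (hx.1.trans h.lt).le
  rw [← H.strictMonoOn_second.le_iff_le hy.le H.x0_le_a6, H.g'_a6,
    ← h.deriv_left_eq (P.hasDerivAt_g x) (P.a_pos.trans hx.1)]
  exact (H.bijOn_secondDescent.mapsTo (Ioc_subset_Icc_self hx)).2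

/-- Beyond `x₁`, prepending the interval from the first valley would gain more. -/
theorem right_le_x1 (H : P.TwoValleys) (h : IsOptimalInterval P.g (P.g' y) x y)
    (hx : x ∈ Ioc P.a P.x0) : y ≤ P.x1 := by
  by_contra! hlt
  have hmem : y ∈ Icc P.a5 P.a6 := ⟨H.x1_mem.1.trans hlt.le, H.right_le_a6 h hx⟩
  have hgain : 0 < P.gainToDescent y :=
    H.isLeast_x1.1.2.trans_lt (H.strictMonoOn_gainToDescent H.x1_mem hmem hlt)
  have hinv1 := H.inv1_mem (H.g'_a1_le hmem.1)
  rw [gainToDescent, H.inv3_g'_right h hx] at hgain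
  exact hgain.not_ge
    (h.netGain_left_nonpos hinv1.1 (hinv1.2.trans (H.a1_lt_a.trans hx.1).le))

end OptimalInterval

/-! ### The maximizers with two valleys -/

variable {β c w y : ℝ}

theorem le_g'_of_mem_ω1inv (H : P.TwoValleys) (hc : IsOptimalLevel P.g β c) (hβ : 0 < β)
    (hy : y ∈ P.ω1inv β) : c ≤ P.g' y := by
  have hinv1 := H.inv1_mem (H.g'_a1_le_of_mem_domω1 hy.1)
  exact hc.le_of_netGain_eq P.hasCoerciveDeriv.strictMono hβ (P.hasCoerciveDeriv.deriv_pos y)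
    hinv1.1 (hinv1.2.trans (H.a1_le_of_mem_domω1 hy.1)) ((P.ω1_eq_netGain y).symm.trans hy.2)

theorem le_g'_of_mem_ω2inv (H : P.TwoValleys) (hc : IsOptimalLevel P.g β c) (hβ : 0 < β)
    (hw : w ∈ P.ω2inv β) : c ≤ P.g' w := by
  have le_of_gain {u : ℝ} (hu : 0 ≤ u) (huw : u ≤ w) (e : netGain P.g (P.g' w) u w = β) :
      c ≤ P.g' w := hc.le_of_netGain_eq P.hasCoerciveDeriv.strictMono hβ
    (P.hasCoerciveDeriv.deriv_pos w) hu huw e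
  rcases lt_or_ge w P.x1 with hlt | hge
  · have hinv3 := H.inv3_mem (H.g'_mem_secondDescent ⟨hw.1, (hlt.trans_le H.x1_mem.2).le⟩)
    exact le_of_gain (P.a_pos.le.trans hinv3.1) (hinv3.2.trans hw.1)
      ((ω2_of_lt hlt).symm.trans hw.2)
  · have hinv1 := H.inv1_mem (H.g'_a1_le (H.x1_mem.1.trans hge))
    refine le_of_gain hinv1.1 (hinv1.2.trans (H.a1_le_of_x0_le hw.1)) ?_
    rw [← ω1_eq_netGain, ← ω2_of_ge hge, hw.2]

theorem mem_M_cases (H : P.TwoValleys) (hc : IsOptimalLevel P.g β c) (hβ : 0 < β) {z : ℝ × ℝ}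
    (hz : z ∈ P.M β) :
    (z ∈ P.zTilde β ∧ ∃ y ∈ P.ω1inv β, P.g' y = c) ∨
      (z ∈ P.zBar β ∧ ∃ w ∈ P.ω2inv β, w ≤ P.x1 ∧ P.g' w = c) := by
  obtain ⟨x, y⟩ := z
  have h := hc.isOptimalInterval hβ hz
  have e : netGain P.g c x y = β := ((hc.mem_iff _).1 hz).2.2
  obtain rfl : P.g' y = c := h.deriv_right_eq (P.hasDerivAt_g y)
  rcases H.left_le_a1_or_mem_Ioc h with hx | hx
  · have hinv1 := H.inv1_g'_right h hx
    have hy : y ∈ P.ω1inv β := ⟨H.right_mem_domω1 h hx, by rw [ω1_eq_netGain, hinv1, e]⟩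
    exact Or.inl ⟨⟨y, hy, congrArg (·, y) hinv1⟩, y, hy, rfl⟩
  · have hinv3 := H.inv3_g'_right h hx
    have hx0 : P.x0 < y := H.x0_lt_right h (hx.1.trans h.lt).le
    have hx1 : y ≤ P.x1 := H.right_le_x1 h hx
    have hy : y ∈ P.ω2inv β :=
      ⟨hx0.le, by rw [H.ω2_of_le hx0 hx1, gainSecondValley, hinv3, e]⟩
    exact Or.inr ⟨⟨y, hy, congrArg (·, y) hinv3⟩, y, hy, hx1, rfl⟩

theorem inv1_mem_M (H : P.TwoValleys) (hc : IsOptimalLevel P.g β c) (h1 : P.a1 ≤ y)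
    (hlow : P.g' P.a1 ≤ P.g' y) (hω : P.ω1 y = β) (e : P.g' y = c) :
    (P.inv1 (P.g' y), y) ∈ P.M β := by
  have hinv1 := H.inv1_mem hlow
  exact (hc.mem_iff _).2 ⟨hinv1.1, hinv1.2.trans h1, by rw [← hω, ω1_eq_netGain, e]⟩

theorem zTilde_subset_M (H : P.TwoValleys) (hc : IsOptimalLevel P.g β c)
    (hy : y ∈ P.ω1inv β) (e : P.g' y = c) : P.zTilde β ⊆ P.M β := by
  rintro _ ⟨x, hx, rfl⟩
  exact H.inv1_mem_M hc (H.a1_le_of_mem_domω1 hx.1) (H.g'_a1_le_of_mem_domω1 hx.1) hx.2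
    ((H.g'_eq_of_mem_ω1inv hx hy).trans e)

/-- At `w = x₁` the value of `ω₂` is taken from the first valley; then `(g')₁⁻¹(g' w)` starts an
optimal interval too, which forces `x₀ < w`, so both valleys yield the same gain. -/
theorem gainSecondValley_eq_of_mem_ω2inv (H : P.TwoValleys) (hc : IsOptimalLevel P.g β c)
    (hβ : 0 < β) (hw : w ∈ P.ω2inv β) (hwx : w ≤ P.x1) (e : P.g' w = c) :
    P.gainSecondValley w = β := by
  rcases hwx.lt_or_eq with hlt | rfl
  · rw [← ω2_of_lt hlt, hw.2]
  · have hω : P.ω1 P.x1 = β := (ω2_of_ge le_rfl).symm.trans hw.2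
    have hM := H.inv1_mem_M hc (H.a1_le_of_x0_le hw.1) (H.g'_a1_le H.x1_mem.1) hω e
    have h := hc.isOptimalInterval hβ hM
    have hx0 : P.x0 < P.x1 := H.x0_lt_right (e.symm ▸ h) (H.a_lt_x0.le.trans hw.1)
    rw [← H.ω2_of_le hx0 le_rfl, hw.2]

theorem zBar_subset_M (H : P.TwoValleys) (hc : IsOptimalLevel P.g β c) (hβ : 0 < β)
    (hw : w ∈ P.ω2inv β) (hwx : w ≤ P.x1) (e : P.g' w = c) : P.zBar β ⊆ P.M β := by
  rintro _ ⟨v, hv, rfl⟩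
  obtain rfl := H.ω2inv_subsingleton β hv hw
  obtain rfl := e
  have hinv3 := H.inv3_mem (H.g'_mem_secondDescent ⟨hv.1, hwx.trans H.x1_mem.2⟩)
  exact (hc.mem_iff _).2 ⟨P.a_pos.le.trans hinv3.1, hinv3.2.trans hv.1,
    H.gainSecondValley_eq_of_mem_ω2inv hc hβ hv hwx rfl⟩

theorem M_eq_zTilde (H : P.TwoValleys) (hc : IsOptimalLevel P.g β c) (hβ : 0 < β)
    (h : ∀ w ∈ P.ω2inv β, w ≤ P.x1 → P.g' w ≠ c) :
    (∃ y ∈ P.ω1inv β, P.g' y = c) ∧ P.M β = P.zTilde β := by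
  have from_first : ∀ z ∈ P.M β, z ∈ P.zTilde β ∧ ∃ y ∈ P.ω1inv β, P.g' y = c := fun z hz =>
    (H.mem_M_cases hc hβ hz).resolve_right fun ⟨_, w, hw, hwx, e⟩ => h w hw hwx e
  obtain ⟨z, hz⟩ := ratioMaximizers_nonempty P.hasCoerciveDeriv hβ
  obtain ⟨-, y, hy, e⟩ := from_first z hz
  exact ⟨⟨y, hy, e⟩, Subset.antisymm (fun z hz => (from_first z hz).1) (H.zTilde_subset_M hc hy e)⟩

theorem M_eq_zTilde_of_mem_A3 (H : P.TwoValleys) (hc : IsOptimalLevel P.g β c) (hβ : 0 < β)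
    (h : β ∈ P.A3) : (∃ y ∈ P.ω1inv β, P.g' y = c) ∧ P.M β = P.zTilde β :=
  H.M_eq_zTilde hc hβ fun _ hw hwx => absurd h ((H.le_x1_iff_notMem_A3 hw).1 hwx)

theorem M_eq_zTilde_of_mem_A1 (H : P.TwoValleys) (hc : IsOptimalLevel P.g β c) (hβ : 0 < β)
    (h : β ∈ P.A1) : (∃ y ∈ P.ω1inv β, P.g' y = c) ∧ P.M β = P.zTilde β := by
  obtain ⟨-, y, hy, hlt⟩ := h
  exact H.M_eq_zTilde hc hβ fun w hw _ =>
    ((H.le_g'_of_mem_ω1inv hc hβ hy).trans_lt (hlt w hw)).ne'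

theorem A2_inter_A3 (H : P.TwoValleys) : P.A2 ∩ P.A3 = ∅ := by
  refine eq_empty_of_forall_notMem fun b ⟨⟨hb, w, hw, hlt⟩, h3⟩ => ?_
  obtain ⟨c, hc⟩ := exists_isOptimalLevel P.hasCoerciveDeriv hb
  obtain ⟨⟨y, hy, e⟩, -⟩ := H.M_eq_zTilde_of_mem_A3 hc hb h3
  exact (H.le_g'_of_mem_ω2inv hc hb hw).not_gt (e ▸ hlt y hy)

theorem ωinv_union_nonempty (H : P.TwoValleys) (hβ : 0 < β) :
    (P.ω1inv β ∪ P.ω2inv β).Nonempty := by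
  obtain ⟨c, hc⟩ := exists_isOptimalLevel P.hasCoerciveDeriv hβ
  obtain ⟨z, hz⟩ := ratioMaximizers_nonempty P.hasCoerciveDeriv hβ
  rcases H.mem_M_cases hc hβ hz with ⟨-, y, hy, -⟩ | ⟨-, w, hw, -⟩
  · exact ⟨y, Or.inl hy⟩
  · exact ⟨w, Or.inr hw⟩

theorem M_eq_zTilde_of_mem_A1_union_A3 (H : P.TwoValleys) (hβ : 0 < β) (h : β ∈ P.A1 ∪ P.A3) :
    (P.ω1inv β).Nonempty ∧ P.M β = P.zTilde β := by
  obtain ⟨c, hc⟩ := exists_isOptimalLevel P.hasCoerciveDeriv hβ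
  obtain ⟨⟨y, hy, -⟩, hM⟩ :=
    h.elim (H.M_eq_zTilde_of_mem_A1 hc hβ) (H.M_eq_zTilde_of_mem_A3 hc hβ)
  exact ⟨⟨y, hy⟩, hM⟩

theorem M_eq_zBar_of_mem_A2 (H : P.TwoValleys) (h : β ∈ P.A2) :
    (P.ω2inv β).Nonempty ∧ P.M β = P.zBar β := by
  obtain ⟨hβ, w, hw, hlt⟩ := h
  obtain ⟨c, hc⟩ := exists_isOptimalLevel P.hasCoerciveDeriv hβ
  have from_second : ∀ z ∈ P.M β, z ∈ P.zBar β ∧ ∃ v ∈ P.ω2inv β, v ≤ P.x1 ∧ P.g' v = c :=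
    fun z hz => (H.mem_M_cases hc hβ hz).resolve_left fun ⟨_, y, hy, e⟩ =>
      (H.le_g'_of_mem_ω2inv hc hβ hw).not_gt (e ▸ hlt y hy)
  obtain ⟨z, hz⟩ := ratioMaximizers_nonempty P.hasCoerciveDeriv hβ
  obtain ⟨-, v, hv, hvx, e⟩ := from_second z hz
  exact ⟨⟨w, hw⟩,
    Subset.antisymm (fun z hz => (from_second z hz).1) (H.zBar_subset_M hc hβ hv hvx e)⟩

theorem exists_ωinv_level_eq (H : P.TwoValleys) (hc : IsOptimalLevel P.g β c) (hβ : 0 < β)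
    (h1 : β ∉ P.A1) (h2 : β ∉ P.A2) :
    (∃ y ∈ P.ω1inv β, P.g' y = c) ∧ ∃ w ∈ P.ω2inv β, P.g' w = c := by
  obtain ⟨z, hz⟩ := ratioMaximizers_nonempty P.hasCoerciveDeriv hβ
  rcases H.mem_M_cases hc hβ hz with ⟨-, y, hy, e⟩ | ⟨-, w, hw, -, e⟩
  · refine ⟨⟨y, hy, e⟩, ?_⟩
    by_contra! hne
    exact h1 ⟨hβ, y, hy, fun w hw => e ▸ (H.le_g'_of_mem_ω2inv hc hβ hw).lt_of_ne' (hne w hw)⟩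
  · refine ⟨?_, w, hw, e⟩
    by_contra! hne
    exact h2 ⟨hβ, w, hw, fun y hy => e ▸ (H.le_g'_of_mem_ω1inv hc hβ hy).lt_of_ne' (hne y hy)⟩

theorem M_eq_zTilde_union_zBar (H : P.TwoValleys) (h : β ∈ Ioi 0 \ (P.A1 ∪ P.A2 ∪ P.A3)) :
    (P.ω1inv β).Nonempty ∧ (P.ω2inv β).Nonempty ∧ P.M β = P.zTilde β ∪ P.zBar β := by
  obtain ⟨hβ, hA⟩ := h
  simp only [mem_union, not_or] at hA
  obtain ⟨⟨h1, h2⟩, h3⟩ := hA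
  obtain ⟨c, hc⟩ := exists_isOptimalLevel P.hasCoerciveDeriv hβ
  obtain ⟨⟨y, hy, ey⟩, w, hw, ew⟩ := H.exists_ωinv_level_eq hc hβ h1 h2
  refine ⟨⟨y, hy⟩, ⟨w, hw⟩, Subset.antisymm
    (fun z hz => (H.mem_M_cases hc hβ hz).imp And.left And.left) (union_subset ?_ ?_)⟩
  · exact H.zTilde_subset_M hc hy ey
  · exact H.zBar_subset_M hc hβ hw ((H.le_x1_iff_notMem_A3 hw).2 h3) ew

end Model.TwoValleys

theorem mainTheorem3 (P : Model) (hμp : 0 < P.μp) (hμm : 0 < P.μm) (β : ℝ) (hβ : 0 < β) :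
    (P.CaseI →
      Set.BijOn (P.φ P.a) (Set.Ici P.a) (Set.Ici 0) ∧
      P.M β = {(P.invL P.a (P.g' (P.φinv P.a β)), P.φinv P.a β)}) ∧
    (P.CaseII →
      Set.BijOn (P.φ P.x0) (Set.Ici P.x0) (Set.Ici 0) ∧
      P.M β = {(P.invL P.x0 (P.g' (P.φinv P.x0 β)), P.φinv P.x0 β)}) ∧
    (P.CaseIII →
      Set.BijOn (P.φ P.a1) (Set.Ici P.a1) (Set.Ici 0) ∧
      P.M β = {(P.invL P.a1 (P.g' (P.φinv P.a1 β)), P.φinv P.a1 β)}) ∧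
    (P.CaseIV →
      -- the inverse branches of `g'` are well defined
      (P.a < P.x0 ∧
        Set.BijOn P.g' (Set.Icc P.a1 P.a) (Set.Icc (P.g' P.a1) (P.g' P.a)) ∧
        Set.BijOn P.g' (Set.Icc P.a P.x0) (Set.Icc (P.g' P.x0) (P.g' P.a)) ∧
        Set.BijOn P.g' (Set.Ici P.x0) (Set.Ici (P.g' P.x0))) ∧
      -- the inverses of `ω₁` and `ω₂` at `β`
      ((P.ω1inv β ∪ P.ω2inv β).Nonempty ∧
        (P.ω2inv β).Subsingleton ∧
        (β ≠ P.ω1 P.x2 → (P.ω1inv β).Subsingleton) ∧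
        (β = P.ω1 P.x2 → P.a5 < P.x2 →
          P.ω1inv β = {P.inv2 (P.g' P.x2), P.x2}) ∧
        (β = P.ω1 P.x2 → P.x2 = P.a5 → P.ω1inv β = {P.x2})) ∧
      -- the maximizers
      (β ∈ P.A1 ∪ P.A3 → (P.ω1inv β).Nonempty ∧ P.M β = P.zTilde β) ∧
      (β ∈ P.A2 ∩ (Set.Ioi 0 \ P.A3) → (P.ω2inv β).Nonempty ∧ P.M β = P.zBar β) ∧
      (β ∈ Set.Ioi 0 \ (P.A1 ∪ P.A2 ∪ P.A3) →
        (P.ω1inv β).Nonempty ∧ (P.ω2inv β).Nonempty ∧ P.M β = P.zTilde β ∪ P.zBar β) ∧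
      P.A2 ∩ P.A3 = ∅) := by
  refine ⟨fun h => ⟨Model.bijOn_φ (h.isValley hμp), Model.M_eq_singleton (h.isValley hμp) hβ⟩,
    fun h => ⟨Model.bijOn_φ (h.isValley hμp), Model.M_eq_singleton (h.isValley hμp) hβ⟩,
    fun h => ⟨Model.bijOn_φ (h.isValley hμp hμm), Model.M_eq_singleton (h.isValley hμp hμm) hβ⟩,
    fun h => ?_⟩
  have H : P.TwoValleys := h.twoValleys hμp hμm
  exact ⟨⟨H.a_lt_x0, H.bijOn_firstAscent, H.bijOn_secondDescent, H.bijOn_secondAscent⟩,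
    ⟨H.ωinv_union_nonempty hβ, H.ω2inv_subsingleton β, H.ω1inv_subsingleton, H.ω1inv_eq_pair,
      H.ω1inv_eq_singleton hβ⟩,
    H.M_eq_zTilde_of_mem_A1_union_A3 hβ, fun hA => H.M_eq_zBar_of_mem_A2 hA.1,
    H.M_eq_zTilde_union_zBar, H.A2_inter_A3⟩
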